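/- **Setting.** Let $(\Omega,\mathcal F,P)$ be a probability space, $\mathsf p\ge 1$ an integer, $\Theta\subset\mathbb R^{\mathsf p}$ a bounded open set, $\theta^*\in\Theta$, and $\mathbb T\subset[0,\infty)$ with $\sup\mathbb T=\infty$. For $T\in\mathbb T$ let $\mathbb H_T:\Omega\times\overline\Theta\to\mathbb R$ be a random field such that, for every $\omega$, $\theta\mapsto\mathbb H_T(\theta)$ is of class $C^2$ on $\Theta$ and continuous on $\overline\Theta$. Let $a_T\in GL(\mathbb R^{\mathsf p})$ with $|a_T|\to0$ as $T\to\infty$, put $b_T=\{\lambda_{\min}(a_T^\star a_T)\}^{-1}$ (where $\star$ is the transpose and $\lambda_{\min},\lambda_{\max}$ are the extreme eigenvalues of a symmetric matrix), and assume $b_T^{-1}\le\lambda_{\max}(a_T^\star a_T)\le C_0b_T^{-1}$ for all $T\in\mathbb T$, for some constant $C_0\in[1,\infty)$. Define $$\Delta_T=\partial_\theta\mathbb H_T(\theta^*)a_T,\qquad \Gamma_T(\theta)=-a_T^\star\,\partial_\theta^2\mathbb H_T(\theta)\,a_T,\qquad \mathbb Y_T(\theta)=b_T^{-1}\{\mathbb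 H_T(\theta)-\mathbb H_T(\theta^*)\},$$ $\Delta_T$ being regarded as a vector in $\mathbb R^{\mathsf p}$. Let $\mathbb Y:\Omega\times\Theta\to\mathbb R$ be a continuous random field and $\Gamma$ a $\mathsf p\times\mathsf p$ symmetric random matrix. Write $U(\theta,r)$ for the open ball of radius $r$ around $\theta$, and $\|V\|_q=(E[|V|^q])^{1/q}$ for $q>0$. **Conditions**, for real parameters $\alpha,\beta_1,\beta_2,\rho_1,\rho_2$ and $L>0$: * [S1] $0<\beta_1<1/2$, $\ 0<\rho_1<\min\{1,\alpha/(1-\alpha),2\beta_1/(1-\alpha)\}$, $\ 0<2\alpha<\rho_2$, $\ \beta_2\ge0$, $\ 1-2\beta_2-\rho_2>0$. * [S2] (i) There is a positive random variable $\chi_0$ such that, almost surely, $\mathbb Y(\theta)=\mathbb Y(\theta)-\mathbb Y(\theta^*)\le-\chi_0|\theta-\theta^*|^2$ for all $\theta\in\Theta$, and, for some constant $C$, $P[\chi_0\le r^{-(\rho_2-2\alpha)}]\le C r^{-L}$ for all $r>0$. (ii) For some constant $C$, $P[\lambda_{\min}(\Gamma)<r^{-\rho_1}]\le C r^{-L}$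 for all $r>0$. * [S3] (i) $\sup_{T\in\mathbb T}\||\Delta_T|\|_{M_1}<\infty$ with $M_1=L(1-\rho_1)^{-1}$. (ii) $\displaystyle\sup_{T\in\mathbb T}\Big\|\sup_{\theta\in\Theta\setminus U(\theta^*,b_T^{-\alpha/2})}b_T^{\frac12-\beta_2}|\mathbb Y_T(\theta)-\mathbb Y(\theta)|\Big\|_{M_2}<\infty$ with $M_2=L(1-2\beta_2-\rho_2)^{-1}$. (iii) $\displaystyle\sup_{T\in\mathbb T}\Big\|\sup_{|u|\le1,\ \theta^*+\delta u\in\Theta}|\Gamma_T(\theta^*+\delta u)-\Gamma_T(\theta^*)|\Big\|_{M_3}=O(\delta)$ as $\delta\downarrow0$, with $M_3=L(\beta-\rho_1)^{-1}$, $\beta=\alpha/(1-\alpha)$. (iv) $\sup_{T\in\mathbb T}\|b_T^{\beta_1}|\Gamma_T(\theta^*)-\Gamma|\|_{M_4}<\infty$ with $M_4=L(2\beta_1(1-\alpha)^{-1}-\rho_1)^{-1}$. **Limit and estimator.** Let $\mathcal G$ be a $\sigma$-field with $\sigma[\Gamma]\subset\mathcal G\subset\mathcal F$, and let $\Delta$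 be a $\mathsf p$-dimensional random vector on an extension of $(\Omega,\mathcal F,P)$, with expectation $\mathbb E$ (that is, on a probability space with a measure-preserving map to $(\Omega,\mathcal F,P)$, through which random variables on $\Omega$ are lifted). The $\mathcal G$-stable convergence $\Delta_T\to^{d_s(\mathcal G)}\Delta$ means that $(\Delta_T,\Psi)\to^d(\Delta,\Psi)$ as $T\to\infty$ for every $\mathcal G$-measurable random variable $\Psi$. For each $T$ let $\hat\theta_T^M:\Omega\to\overline\Theta$ be any quasi-maximum likelihood estimator (QMLE), i.e. a measurable map with $\mathbb H_T(\hat\theta_T^M)=\max_{\theta\in\overline\Theta}\mathbb H_T(\theta)$, and put $\hat u_T^M=a_T^{-1}(\hat\theta_T^M-\theta^*)$ and $\hat u=\Gamma^{-1}\Delta$. **Theorem.** Let $L>p>0$. Suppose that [S1], [S2] and [S3] are satisfied and that $\Delta_T\to^{d_s(\mathcal G)}\Delta$ as $T\to\infty$. Then: (a) $\hat u_T^M-\Gamma^{-1}\Delta_T\to0$ in probability as $T\to\infty$. (b) For every bounded $\mathcal G$-measurable random variable $\Phi$ and every $f\in C(\mathbb R^{\mathsf p})$ with $\limsup_{|u|\to\infty}|u|^{-p}|f(u)|<\infty$,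 the variables $f(\hat u_T^M)\Phi$ and $f(\hat u)\Phi$ are integrable and $$E[f(\hat u_T^M)\Phi]\to\mathbb E[f(\hat u)\Phi]\qquad(T\to\infty).$$ -/

import Mathlib

open MeasureTheory Filter
open scoped Topology ENNReal Matrix.Norms.Frobenius

noncomputable section

namespace QLA

/-- The parameter space `ℝ^d` with its Euclidean norm. -/
abbrev E (d : ℕ) : Type := EuclideanSpace ℝ (Fin d)

/-- Real square matrices of size `d`; `‖M‖` is the Frobenius norm `(∑ i j, M i j ^ 2) ^ (1/2)`. -/
abbrev Mat (d : ℕ) : Type := Matrix (Fin d) (Fin d) ℝ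

/-- The smallest eigenvalue of a symmetric matrix. -/
def lambdaMin {d : ℕ} (M : Mat d) : ℝ := sInf (spectrum ℝ M)

/-- The largest eigenvalue of a symmetric matrix. -/
def lambdaMax {d : ℕ} (M : Mat d) : ℝ := sSup (spectrum ℝ M)

/-- The action `u ↦ M u` of a matrix on Euclidean vectors. -/
def act {d : ℕ} (M : Mat d) (u : E d) : E d := Matrix.toEuclideanLin M u

/-- The Hessian matrix of second-order partial derivatives of `h` at `θ`. -/
def hessian {d : ℕ} (h : E d → ℝ) (θ : E d) : Mat d :=
  Matrix.of fun i j =>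
    fderiv ℝ (fderiv ℝ h) θ (EuclideanSpace.single i 1) (EuclideanSpace.single j 1)

/-- `b = (λ_min (aᵀ a))⁻¹` for a scaling matrix `a`. -/
def rate {d : ℕ} (a : Mat d) : ℝ := (lambdaMin (a.transpose * a))⁻¹

/-- The score `∂_θ h(θ) a`, written as the column vector `aᵀ ∇h(θ)`. -/
def score {d : ℕ} (a : Mat d) (h : E d → ℝ) (θ : E d) : E d :=
  act a.transpose (gradient h θ)

/-- The observed information `- aᵀ ∂_θ² h(θ) a`. -/
def info {d : ℕ} (a : Mat d) (h : E d → ℝ) (θ : E d) : Mat d :=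
  -(a.transpose * hessian h θ * a)

/-- The normalized contrast `b⁻¹ (h(θ) - h(θ*))`. -/
def contrast {d : ℕ} (a : Mat d) (h : E d → ℝ) (θstar θ : E d) : ℝ :=
  (rate a)⁻¹ * (h θ - h θstar)

/-- The tuning parameters `α, β₁, β₂, ρ₁, ρ₂`. -/
structure Params where
  α : ℝ
  β₁ : ℝ
  β₂ : ℝ
  ρ₁ : ℝ
  ρ₂ : ℝ

/-- Condition [S1]. -/
structure CondS1 (q : Params) : Prop where
  β₁_pos : 0 < q.β₁
  β₁_lt : q.β₁ < 1 / 2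
  ρ₁_pos : 0 < q.ρ₁
  ρ₁_lt : q.ρ₁ < min 1 (min (q.α / (1 - q.α)) (2 * q.β₁ / (1 - q.α)))
  α_pos : 0 < 2 * q.α
  α_lt : 2 * q.α < q.ρ₂
  β₂_nonneg : 0 ≤ q.β₂
  sum_lt : 0 < 1 - 2 * q.β₂ - q.ρ₂

/-- Condition [S2] for the limit field `Y` and the limit information `Γ`. -/
structure CondS2 {Ω : Type*} [MeasurableSpace Ω] (P : Measure Ω) {d : ℕ} (q : Params) (L : ℝ)
    (Θ : Set (E d)) (θstar : E d) (Y : Ω → E d → ℝ) (Γ : Ω → Mat d) : Prop where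
  identifiability : ∃ χ : Ω → ℝ, Measurable χ ∧ (∀ᵐ ω ∂P, 0 < χ ω) ∧
    (∀ᵐ ω ∂P, ∀ θ ∈ Θ, Y ω θ = Y ω θ - Y ω θstar ∧
      Y ω θ - Y ω θstar ≤ -(χ ω * ‖θ - θstar‖ ^ 2)) ∧
    ∃ C : ℝ, ∀ r : ℝ, 0 < r →
      P.real {ω | χ ω ≤ r ^ (-(q.ρ₂ - 2 * q.α))} ≤ C / r ^ L
  nondegeneracy : ∃ C : ℝ, ∀ r : ℝ, 0 < r →
    P.real {ω | lambdaMin (Γ ω) < r ^ (-q.ρ₁)} ≤ C / r ^ L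

/-- Condition [S3] for the family of random fields `H`, scaled by the matrices `a`. All suprema are
taken in `[0, ∞]`, and `eLpNorm X (ENNReal.ofReal M) P` is `(E |X|^M)^(1/M)`. -/
structure CondS3 {Ω : Type*} [MeasurableSpace Ω] (P : Measure Ω) {d : ℕ} {ι : Type*}
    (q : Params) (L : ℝ) (Θ : Set (E d)) (θstar : E d) (a : ι → Mat d)
    (H : ι → Ω → E d → ℝ) (Y : Ω → E d → ℝ) (Γ : Ω → Mat d) : Prop where
  score_moment :
    ⨆ T, eLpNorm (fun ω => score (a T) (H T ω) θstar)
      (ENNReal.ofReal (L * (1 - q.ρ₁)⁻¹)) P < ∞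
  contrast_moment :
    ⨆ T, eLpNorm
      (fun ω => ⨆ θ ∈ Θ \ Metric.ball θstar (rate (a T) ^ (-q.α / 2)),
        ENNReal.ofReal (rate (a T) ^ (1 / 2 - q.β₂) *
          |contrast (a T) (H T ω) θstar θ - Y ω θ|))
      (ENNReal.ofReal (L * (1 - 2 * q.β₂ - q.ρ₂)⁻¹)) P < ∞
  info_modulus :
    ∃ C : ℝ, ∀ᶠ δ : ℝ in 𝓝[>] 0,
      ⨆ T, eLpNorm
        (fun ω => ⨆ u ∈ {u : E d | θstar + δ • u ∈ Θ ∧ ‖u‖ ≤ 1},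
          ENNReal.ofReal
            ‖info (a T) (H T ω) (θstar + δ • u) - info (a T) (H T ω) θstar‖)
        (ENNReal.ofReal (L * (q.α / (1 - q.α) - q.ρ₁)⁻¹)) P ≤ ENNReal.ofReal (C * δ)
  info_moment :
    ⨆ T, eLpNorm
      (fun ω => rate (a T) ^ q.β₁ * ‖info (a T) (H T ω) θstar - Γ ω‖)
      (ENNReal.ofReal (L * (2 * q.β₁ * (1 - q.α)⁻¹ - q.ρ₁)⁻¹)) P < ∞

/-- `θhat` is a quasi-maximum likelihood estimator for the random field `h` on `closure Θ`. -/
structure IsQMLE {Ω : Type*} [MeasurableSpace Ω] {d : ℕ} (Θ : Set (E d))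
    (h : Ω → E d → ℝ) (θhat : Ω → E d) : Prop where
  measurable : Measurable θhat
  mem_closure : ∀ ω, θhat ω ∈ closure Θ
  isMax : ∀ ω, ∀ θ ∈ closure Θ, h ω θ ≤ h ω (θhat ω)

/-- `𝒢`-stable convergence in law of `V T` along the filter `l` to `V'`, where `V'` lives on an
extension `(Ω', P')` of `(Ω, P)` with projection `π : Ω' → Ω`: for every `𝒢`-measurable real
random variable `Ψ`, the pair `(V T, Ψ)` converges in law to `(V', Ψ ∘ π)`. -/
def StableTendsto {Ω Ω' : Type*} (𝒢 : MeasurableSpace Ω) [MeasurableSpace Ω] [MeasurableSpace Ω']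
    (P : Measure Ω) [IsProbabilityMeasure P] (P' : Measure Ω') [IsProbabilityMeasure P']
    (π : Ω' → Ω) {d : ℕ} {ι : Type*} (V : ι → Ω → E d)
    (l : Filter ι) (V' : Ω' → E d) : Prop :=
  ∀ Ψ : Ω → ℝ, Measurable[𝒢] Ψ →
    TendstoInDistribution (fun T ω => (V T ω, Ψ ω)) l (fun ω' => (V' ω', Ψ (π ω')))
      (fun _ => P) P'

end QLA

end

/-! Write u for the normalized error `act a⁻¹ (θhat - θstar)`, b for `rate a` and Δ_T for the score.
Everything rests on a tail bound P(|u| ≥ r) ≤ C r^(-L), valid for all r > 0 once T is large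
(`Setting.exists_error_tail`). The event is split at |u| = b^((1-α)/2), which corresponds to |θhat -
θstar| of order b^(-α/2).

Far from θstar the contrast is nonnegative at the maximizer, while its limit Y lies below -χ|θ -
θstar|². Hence either χ is small or the contrast is far from Y (`measureReal_far_le`). Near θstar
the maximizer is interior, and integrating the Hessian along the segment to it gives |Γu - Δ_T| ≤
D|u|, where D controls the oscillation of the observed information plus its distance from Γ
(`norm_act_sub_score_le`). Unless λ_min(Γ) is small, |u| ≥ r then forces Δ_T or D to be large
(`measureReal_near_le`). The moment orders in [S3] are such that Markov's inequality yields r^(-L)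
every time.

For (a), the same linearization bounds Γ(u - Γ⁻¹Δ_T) by D|u|, with D small in probability and u
asymptotically tight (`Setting.tendstoInMeasure`).

For (b), Γ⁻¹ is 𝒢-measurable, so stable convergence of Δ_T passes to Γ⁻¹Δ_T after approximating Γ⁻¹
by simple matrices (`StableTendsto.tendsto_integral_act`). By (a) the limit carries over to u for
compactly supported test functions. The tail bound controls moments of an order s strictly between p
and L, which removes the truncation (`StableTendsto.tendsto_integral_of_growth`). -/

noncomputable section

namespace QLA

/-! ### Quadratic forms, extreme eigenvalues and the rate. -/

section LinearAlgebra

variable {d : ℕ}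

theorem act_sub_left (M N : Mat d) (u : E d) : act (M - N) u = act M u - act N u := by
  simp [act]

theorem act_neg_left (M : Mat d) (u : E d) : act (-M) u = -act M u := by
  simp [act]

theorem act_sub (M : Mat d) (u v : E d) : act M (u - v) = act M u - act M v := by
  simp [act]

theorem act_mul (M N : Mat d) (u : E d) : act (M * N) u = act M (act N u) := by
  simp [act, Matrix.toLpLin_apply, Matrix.mulVec_mulVec]

theorem act_one (u : E d) : act (1 : Mat d) u = u := by
  simp [act]

theorem act_smul_one (c : ℝ) (u : E d) : act (c • (1 : Mat d)) u = c • u := by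
  simp [act]

theorem act_apply (M : Mat d) (u : E d) (i : Fin d) : act M u i = ∑ j, M i j * u j := by
  simp [act, Matrix.toLpLin_apply, Matrix.mulVec, dotProduct]

theorem inner_act_eq_sum (M : Mat d) (u v : E d) :
    inner ℝ u (act M v) = ∑ i, ∑ j, u i * (M i j * v j) := by
  simp [PiLp.inner_apply, act_apply, Finset.mul_sum, mul_comm]

theorem inner_act_left (M : Mat d) (u v : E d) :
    inner ℝ (act M u) v = inner ℝ u (act M.transpose v) := by
  rw [real_inner_comm, inner_act_eq_sum, inner_act_eq_sum, Finset.sum_comm]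
  refine Finset.sum_congr rfl fun i _ => Finset.sum_congr rfl fun j _ => ?_
  simp only [Matrix.transpose_apply]; ring

theorem norm_act_le (M : Mat d) (u : E d) : ‖act M u‖ ≤ ‖M‖ * ‖u‖ := by
  have h := Matrix.frobenius_norm_mul M (Matrix.replicateCol Unit (u : Fin d → ℝ))
  rw [← Matrix.replicateCol_mulVec, Matrix.frobenius_norm_replicateCol,
    Matrix.frobenius_norm_replicateCol] at h
  simpa [act, Matrix.toLpLin_apply] using h

theorem continuous_act (M : Mat d) : Continuous (act M) :=
  LinearMap.continuous_of_finiteDimensional (Matrix.toEuclideanLin M)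

theorem inner_act_self_nonneg {M : Mat d} (hM : M.PosSemidef) (u : E d) :
    0 ≤ inner ℝ u (act M u) := by
  have h := hM.dotProduct_mulVec_nonneg (u : Fin d → ℝ)
  rw [inner_act_eq_sum]
  simpa [dotProduct, Matrix.mulVec, Finset.mul_sum] using h

theorem bddBelow_spectrum (M : Mat d) : BddBelow (spectrum ℝ M) :=
  (Matrix.finite_spectrum M).bddBelow

theorem bddAbove_spectrum (M : Mat d) : BddAbove (spectrum ℝ M) :=
  (Matrix.finite_spectrum M).bddAbove

theorem isHermitian_of_isSymm {M : Mat d} (hM : M.IsSymm) : M.IsHermitian := by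
  rw [Matrix.IsHermitian, Matrix.conjTranspose_eq_transpose_of_trivial]; exact hM

/-- Subtracting λ_min times the identity shifts the spectrum into [0, ∞), so the difference is
positive semidefinite. -/
theorem lambdaMin_mul_sq_le {M : Mat d} (hM : M.IsSymm) (u : E d) :
    lambdaMin M * ‖u‖ ^ 2 ≤ inner ℝ u (act M u) := by
  have hS : (M - lambdaMin M • (1 : Mat d)).PosSemidef := by
    rw [Matrix.posSemidef_iff_isHermitian_and_spectrum_nonneg]
    refine ⟨isHermitian_of_isSymm (hM.sub (Matrix.isSymm_one.smul _)), ?_⟩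
    intro x hx
    rw [← Algebra.algebraMap_eq_smul_one, ← spectrum.sub_singleton_eq] at hx
    obtain ⟨y, hy, z, hz, rfl⟩ := Set.mem_sub.1 hx
    rw [Set.mem_singleton_iff] at hz
    subst hz
    exact sub_nonneg.2 (csInf_le (bddBelow_spectrum M) hy)
  have h := inner_act_self_nonneg hS u
  rw [act_sub_left, act_smul_one, inner_sub_right, inner_smul_right,
    real_inner_self_eq_norm_sq] at h
  linarith

theorem inner_act_le_lambdaMax {M : Mat d} (hM : M.IsSymm) (u : E d) :
    inner ℝ u (act M u) ≤ lambdaMax M * ‖u‖ ^ 2 := by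
  have hS : (lambdaMax M • (1 : Mat d) - M).PosSemidef := by
    rw [Matrix.posSemidef_iff_isHermitian_and_spectrum_nonneg]
    refine ⟨isHermitian_of_isSymm ((Matrix.isSymm_one.smul _).sub hM), ?_⟩
    intro x hx
    rw [← Algebra.algebraMap_eq_smul_one, ← spectrum.singleton_sub_eq] at hx
    obtain ⟨z, hz, y, hy, rfl⟩ := Set.mem_sub.1 hx
    rw [Set.mem_singleton_iff] at hz
    subst hz
    exact sub_nonneg.2 (le_csSup (bddAbove_spectrum M) hy)
  have h := inner_act_self_nonneg hS u
  rw [act_sub_left, act_smul_one, inner_sub_right, inner_smul_right,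
    real_inner_self_eq_norm_sq] at h
  linarith

theorem isSymm_transpose_mul_self (a : Mat d) : (a.transpose * a).IsSymm := by
  simp [Matrix.IsSymm]

theorem inner_act_gram (a : Mat d) (u : E d) :
    inner ℝ u (act (a.transpose * a) u) = ‖act a u‖ ^ 2 := by
  rw [act_mul, ← inner_act_left, real_inner_self_eq_norm_sq]

/-- Positive dimension makes the spectrum of aᵀa nonempty, so the infimum is an actual eigenvalue of
a positive definite matrix. -/
theorem rate_pos (hd : 0 < d) (a : GL (Fin d) ℝ) : 0 < rate (a : Mat d) := by
  have : Nonempty (Fin d) := ⟨⟨0, hd⟩⟩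
  have hP : ((a : Mat d).transpose * (a : Mat d)).PosDef := by
    rw [← Matrix.conjTranspose_eq_transpose_of_trivial]
    refine Matrix.PosDef.conjTranspose_mul_self _ ?_
    exact Matrix.mulVec_injective_of_isUnit a.isUnit
  have hne : (spectrum ℝ ((a : Mat d).transpose * (a : Mat d))).Nonempty := by
    rw [hP.isHermitian.spectrum_real_eq_range_eigenvalues]
    exact Set.range_nonempty _
  have hm := hne.csInf_mem (Matrix.finite_spectrum _)
  rw [hP.isHermitian.spectrum_real_eq_range_eigenvalues] at hm
  obtain ⟨i, hi⟩ := hm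
  rw [rate, inv_pos, lambdaMin, hP.isHermitian.spectrum_real_eq_range_eigenvalues, ← hi]
  exact hP.eigenvalues_pos i

theorem inv_rate_mul_sq_le (a : Mat d) (u : E d) : (rate a)⁻¹ * ‖u‖ ^ 2 ≤ ‖act a u‖ ^ 2 := by
  rw [← inner_act_gram, rate, inv_inv]
  exact lambdaMin_mul_sq_le (isSymm_transpose_mul_self a) u

theorem sq_norm_act_le_lambdaMax (a : Mat d) (u : E d) :
    ‖act a u‖ ^ 2 ≤ lambdaMax (a.transpose * a) * ‖u‖ ^ 2 := by
  rw [← inner_act_gram]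
  exact inner_act_le_lambdaMax (isSymm_transpose_mul_self a) u

/-- Tested on one unit vector; this is how `a → 0` forces the rate to infinity. -/
theorem inv_rate_le_sq_norm (hd : 0 < d) (a : Mat d) : (rate a)⁻¹ ≤ ‖a‖ ^ 2 := by
  have h := inv_rate_mul_sq_le a (EuclideanSpace.single (⟨0, hd⟩ : Fin d) (1 : ℝ))
  have h2 := norm_act_le a (EuclideanSpace.single (⟨0, hd⟩ : Fin d) (1 : ℝ))
  simp only [PiLp.norm_single, norm_one, one_pow, mul_one] at h h2
  exact h.trans (pow_le_pow_left₀ (norm_nonneg _) h2 2)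

theorem act_inv_act (a : GL (Fin d) ℝ) (u : E d) : act (a : Mat d) (act (a : Mat d)⁻¹ u) = u := by
  rw [← act_mul, Matrix.mul_nonsing_inv _ ((Matrix.isUnit_iff_isUnit_det _).1 a.isUnit), act_one]

theorem isUnit_of_lambdaMin_pos {M : Mat d} (hM : M.IsSymm) (h : 0 < lambdaMin M) :
    IsUnit M := by
  rw [← Matrix.mulVec_injective_iff_isUnit]
  refine (injective_iff_map_eq_zero (Matrix.mulVecLin M)).2 fun v hv => ?_
  have h1 := lambdaMin_mul_sq_le hM (WithLp.toLp 2 v)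
  have h2 : act M (WithLp.toLp 2 v) = 0 := by
    have : M.mulVec v = 0 := hv
    simp [act, Matrix.toLpLin_apply, this]
  rw [h2, inner_zero_right] at h1
  have h3 : ‖(WithLp.toLp 2 v : E d)‖ ^ 2 ≤ 0 := by
    by_contra hcon
    push Not at hcon
    have := mul_pos h hcon
    linarith
  have h4 : ‖(WithLp.toLp 2 v : E d)‖ = 0 := by
    nlinarith [norm_nonneg (WithLp.toLp 2 v : E d)]
  have h5 : (WithLp.toLp 2 v : E d) = 0 := norm_eq_zero.1 h4
  simpa using congrArg WithLp.ofLp h5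

theorem bilin_eq_inner_act (B : E d →L[ℝ] E d →L[ℝ] ℝ) (u v : E d) :
    B u v = inner ℝ u (act (Matrix.of fun i j =>
      B (EuclideanSpace.single i 1) (EuclideanSpace.single j 1)) v) := by
  rw [inner_act_eq_sum]
  have hu : u = ∑ i, u i • EuclideanSpace.single i (1 : ℝ) := by
    ext k; simp [Finset.sum_apply, Pi.single_apply]
  have hv : v = ∑ i, v i • EuclideanSpace.single i (1 : ℝ) := by
    ext k; simp [Finset.sum_apply, Pi.single_apply]
  conv_lhs => rw [hu, hv]
  simp only [map_sum, map_smul, _root_.sum_apply, _root_.smul_apply,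
    smul_eq_mul, Matrix.of_apply, Finset.mul_sum]
  rw [Finset.sum_comm]
  refine Finset.sum_congr rfl fun i _ => Finset.sum_congr rfl fun j _ => ?_
  ring

end LinearAlgebra

/-! ### Linearization of the score equation. -/

section Calculus

variable {d : ℕ} {Θ : Set (E d)} {h : E d → ℝ} {a : Mat d}

theorem fderiv_fderiv_eq_inner_info (a : Mat d) (h : E d → ℝ) (θ u v : E d) :
    fderiv ℝ (fderiv ℝ h) θ (act a u) (act a v) = -inner ℝ u (act (info a h θ) v) := by
  rw [bilin_eq_inner_act, inner_act_left, ← act_mul, ← act_mul, info, act_neg_left,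
    inner_neg_right, neg_neg]
  rfl

theorem inner_score (a : Mat d) (h : E d → ℝ) (θ v : E d) :
    inner ℝ (score a h θ) v = fderiv ℝ h θ (act a v) := by
  rw [score, inner_act_left, Matrix.transpose_transpose, gradient]
  exact InnerProductSpace.toDual_symm_apply

theorem hasFDerivAt_fderiv (hΘ : IsOpen Θ) (hh : ContDiffOn ℝ 2 h Θ) {θ : E d} (hθ : θ ∈ Θ) :
    HasFDerivAt (fderiv ℝ h) (fderiv ℝ (fderiv ℝ h) θ) θ := by
  have h1 : ContDiffOn ℝ 1 (fderiv ℝ h) Θ := hh.fderiv_of_isOpen hΘ (by norm_num)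
  exact ((h1.contDiffAt (hΘ.mem_nhds hθ)).differentiableAt (by norm_num)).hasFDerivAt

/-- The score equation at an interior maximum, linearized along the segment from `θ`. -/
theorem norm_act_sub_score_le (hΘ : IsOpen Θ) (hh : ContDiffOn ℝ 2 h Θ) {G : Mat d}
    (hG : G.IsSymm) {θ θ' u : E d} (hseg : segment ℝ θ θ' ⊆ Θ) (hmax : ∀ x ∈ Θ, h x ≤ h θ')
    (hu : act a u = θ' - θ) {D : ℝ} (hD : ∀ x ∈ segment ℝ θ θ', ‖info a h x - G‖ ≤ D) :
    ‖act G u - score a h θ‖ ≤ D * ‖u‖ := by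
  have hθ' : θ' ∈ Θ := hseg (right_mem_segment ℝ θ θ')
  have hD0 : 0 ≤ D := (norm_nonneg _).trans (hD θ (left_mem_segment ℝ θ θ'))
  have hcrit : fderiv ℝ h θ' = 0 := by
    refine IsLocalMax.fderiv_eq_zero ?_
    filter_upwards [hΘ.mem_nhds hθ'] with x hx using hmax x hx
  have key : ∀ v : E d, ‖inner ℝ (act G u - score a h θ) v‖ ≤ D * ‖u‖ * ‖v‖ := by
    intro v
    -- The linear term is chosen so that φ runs from ⟨score, v⟩ to ⟨Gu, v⟩, the gradient being zero
    -- at θ', while φ' only sees the difference between the observed information and G.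
    set φ : ℝ → ℝ := fun s => fderiv ℝ h (θ + s • (θ' - θ)) (act a v)
      + s * inner ℝ (act G u) v with hφ
    have hmem : ∀ s ∈ Set.Icc (0 : ℝ) 1, θ + s • (θ' - θ) ∈ segment ℝ θ θ' := by
      intro s hs
      rw [segment_eq_image']
      exact ⟨s, hs, rfl⟩
    have hder : ∀ s ∈ Set.Icc (0 : ℝ) 1, HasDerivAt φ
        (fderiv ℝ (fderiv ℝ h) (θ + s • (θ' - θ)) (θ' - θ) (act a v)
          + inner ℝ (act G u) v) s := by
      intro s hs
      have h1 : HasDerivAt (fun s : ℝ => θ + s • (θ' - θ)) (θ' - θ) s := by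
        simpa using ((hasDerivAt_id s).smul_const (θ' - θ)).const_add θ
      have h2 := (hasFDerivAt_fderiv hΘ hh (hseg (hmem s hs))).comp_hasDerivAt s h1
      have h3 := (ContinuousLinearMap.apply ℝ ℝ (act a v)).hasFDerivAt.comp_hasDerivAt s h2
      have h4 := h3.add ((hasDerivAt_id s).mul_const (inner ℝ (act G u) v))
      refine h4.congr_deriv ?_
      simp
    have hbound : ∀ s ∈ Set.Icc (0 : ℝ) 1,
        ‖fderiv ℝ (fderiv ℝ h) (θ + s • (θ' - θ)) (θ' - θ) (act a v)
          + inner ℝ (act G u) v‖ ≤ D * ‖u‖ * ‖v‖ := by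
      intro s hs
      have h1 : fderiv ℝ (fderiv ℝ h) (θ + s • (θ' - θ)) (θ' - θ) (act a v)
          + inner ℝ (act G u) v
          = -inner ℝ u (act (info a h (θ + s • (θ' - θ)) - G) v) := by
        rw [← hu, fderiv_fderiv_eq_inner_info, inner_act_left, act_sub_left, inner_sub_right,
          hG.eq]
        ring
      rw [h1, norm_neg]
      calc _ ≤ ‖u‖ * ‖act (info a h (θ + s • (θ' - θ)) - G) v‖ := norm_inner_le_norm _ _
        _ ≤ ‖u‖ * (D * ‖v‖) := by
          gcongr
          exact (norm_act_le _ _).trans (by gcongr; exact hD _ (hmem s hs))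
        _ = D * ‖u‖ * ‖v‖ := by ring
    have hmv := (convex_Icc (0 : ℝ) 1).norm_image_sub_le_of_norm_hasDerivWithin_le
      (fun s hs => (hder s hs).hasDerivWithinAt) hbound
      (Set.left_mem_Icc.2 zero_le_one) (Set.right_mem_Icc.2 zero_le_one)
    have h0 : φ 0 = inner ℝ (score a h θ) v := by
      rw [inner_score]; simp [hφ]
    have h1 : φ 1 = inner ℝ (act G u) v := by
      simp [hφ, hcrit]
    rw [h0, h1, ← inner_sub_left] at hmv
    simpa using hmv
  by_cases hz : act G u - score a h θ = 0
  · rw [hz, norm_zero]; positivity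
  -- Duality: testing against the vector itself recovers its norm.
  · have h1 := key (act G u - score a h θ)
    rw [real_inner_self_eq_norm_sq, Real.norm_eq_abs, abs_of_nonneg (sq_nonneg _), sq] at h1
    exact le_of_mul_le_mul_right h1 (norm_pos_iff.2 hz)

end Calculus

/-! ### Measurability of derivatives and suprema, and Markov's inequality. -/

section Measurability

variable {d : ℕ} {Ω : Type*} [MeasurableSpace Ω]

theorem norm_eq_sqrt_sum (A : Mat d) : ‖A‖ = √(∑ i, ∑ j, A i j ^ 2) := by
  rw [Matrix.frobenius_norm_def, Real.sqrt_eq_rpow]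
  simp

theorem measurable_norm_of_entries {A : Ω → Mat d} (hA : ∀ i j, Measurable fun ω => A ω i j) :
    Measurable fun ω => ‖A ω‖ := by
  simp only [norm_eq_sqrt_sum]
  fun_prop

theorem continuousOn_norm_of_entries {X : Type*} [TopologicalSpace X] {s : Set X} {A : X → Mat d}
    (hA : ∀ i j, ContinuousOn (fun x => A x i j) s) : ContinuousOn (fun x => ‖A x‖) s := by
  simp only [norm_eq_sqrt_sum]
  fun_prop

/-- A supremum of a field that is continuous in the parameter is attained on a countable set. -/
theorem measurable_biSup_of_continuousOn {X : Type*} [TopologicalSpace X]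
    [SecondCountableTopology X] {s : Set X} {g : Ω → X → ℝ≥0∞}
    (hm : ∀ x ∈ s, Measurable fun ω => g ω x) (hc : ∀ ω, ContinuousOn (g ω) s) :
    Measurable fun ω => ⨆ x ∈ s, g ω x := by
  -- One dense set serves all ω: each sublevel set used below is closed in `s` and contains `D`.
  obtain ⟨D, hDc, hD⟩ := TopologicalSpace.exists_countable_dense s
  have heq : (fun ω => ⨆ x ∈ s, g ω x) = fun ω => ⨆ x ∈ D, g ω x := by
    funext ω
    apply le_antisymm
    · rw [iSup_subtype']
      refine iSup_le fun x => ?_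
      have hcont : Continuous (s.domRestrict (g ω)) := continuousOn_iff_continuous_domRestrict.1 (hc ω)
      have hcl : IsClosed {y : s | g ω y ≤ ⨆ x ∈ D, g ω x} :=
        isClosed_le hcont continuous_const
      have hsub : D ⊆ {y : s | g ω y ≤ ⨆ x ∈ D, g ω x} := fun y hy =>
        le_iSup₂ (f := fun (x : s) (_ : x ∈ D) => g ω x) y hy
      exact closure_minimal hsub hcl (hD x)
    · exact iSup₂_le fun x _ => le_iSup₂ (f := fun (x : X) (_ : x ∈ s) => g ω x) x.1 x.2
  rw [heq]
  exact Measurable.biSup D hDc fun x _ => hm x.1 x.2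

/-- A directional derivative is a limit of difference quotients. Quotients leaving Θ, where
measurability is not assumed, are replaced by 0; this affects no large n because Θ is open. -/
theorem measurable_fderiv_apply {Θ : Set (E d)} (hΘ : IsOpen Θ) {g : Ω → E d → ℝ}
    (hm : ∀ θ ∈ Θ, Measurable fun ω => g ω θ) {θ : E d} (hθ : θ ∈ Θ)
    (hd : ∀ ω, DifferentiableAt ℝ (g ω) θ) (v : E d) :
    Measurable fun ω => fderiv ℝ (g ω) θ v := by
  classical
  let c : ℕ → ℝ := fun n => n
  let F : ℕ → Ω → ℝ := fun n ω =>
    if θ + (c n)⁻¹ • v ∈ Θ then c n • (g ω (θ + (c n)⁻¹ • v) - g ω θ) else 0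
  have hF : ∀ n, Measurable (F n) := by
    intro n
    by_cases h : θ + (c n)⁻¹ • v ∈ Θ
    · simp only [F, h, if_true]
      exact ((hm _ h).sub (hm θ hθ)).const_smul (c n)
    · simp only [F, h, if_false]
      exact measurable_const
  refine measurable_of_tendsto_metrizable hF (tendsto_pi_nhds.2 fun ω => ?_)
  have hc : Tendsto (fun n => ‖c n‖) atTop atTop := by
    simpa [c] using tendsto_natCast_atTop_atTop (R := ℝ)
  refine ((hd ω).hasFDerivAt.lim v hc).congr' ?_
  have hlim : Tendsto (fun n => θ + (c n)⁻¹ • v) atTop (𝓝 θ) := by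
    have : Tendsto (fun n : ℕ => (c n)⁻¹) atTop (𝓝 0) :=
      tendsto_inv_atTop_zero.comp tendsto_natCast_atTop_atTop
    simpa using (this.smul_const v).const_add θ
  filter_upwards [hlim (hΘ.mem_nhds hθ)] with n hn
  have hn' : θ + (c n)⁻¹ • v ∈ Θ := hn
  simp only [F, hn', if_true]

theorem measurable_hessian {Θ : Set (E d)} (hΘ : IsOpen Θ) {h : Ω → E d → ℝ}
    (hm : ∀ θ ∈ Θ, Measurable fun ω => h ω θ) (hC : ∀ ω, ContDiffOn ℝ 2 (h ω) Θ)
    {θ : E d} (hθ : θ ∈ Θ) (i j : Fin d) : Measurable fun ω => hessian (h ω) θ i j := by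
  have hd2 : ∀ ω, ∀ x ∈ Θ, HasFDerivAt (fun y => fderiv ℝ (h ω) y (EuclideanSpace.single j 1))
      ((ContinuousLinearMap.apply ℝ ℝ (EuclideanSpace.single j (1 : ℝ))).comp
        (fderiv ℝ (fderiv ℝ (h ω)) x)) x := fun ω x hx =>
    (ContinuousLinearMap.apply ℝ ℝ (EuclideanSpace.single j (1 : ℝ))).hasFDerivAt.comp x
      (hasFDerivAt_fderiv hΘ (hC ω) hx)
  have h1 : ∀ x ∈ Θ, Measurable fun ω => fderiv ℝ (h ω) x (EuclideanSpace.single j 1) :=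
    fun x hx => measurable_fderiv_apply hΘ hm hx
      (fun ω => ((hC ω).contDiffAt (hΘ.mem_nhds hx)).differentiableAt (by norm_num)) _
  have h2 := measurable_fderiv_apply hΘ h1 hθ (fun ω => (hd2 ω θ hθ).differentiableAt)
    (EuclideanSpace.single i 1)
  simp only [(hd2 _ θ hθ).fderiv] at h2
  exact h2

theorem measurable_info {Θ : Set (E d)} (hΘ : IsOpen Θ) {h : Ω → E d → ℝ}
    (hm : ∀ θ ∈ Θ, Measurable fun ω => h ω θ) (hC : ∀ ω, ContDiffOn ℝ 2 (h ω) Θ)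
    (a : Mat d) {θ : E d} (hθ : θ ∈ Θ) (i j : Fin d) :
    Measurable fun ω => info a (h ω) θ i j := by
  have := fun i j => measurable_hessian hΘ hm hC hθ i j
  simp only [info, Matrix.neg_apply, Matrix.mul_apply]
  fun_prop

theorem continuousOn_info {Θ : Set (E d)} (hΘ : IsOpen Θ) {h : E d → ℝ}
    (hC : ContDiffOn ℝ 2 h Θ) (a : Mat d) (i j : Fin d) :
    ContinuousOn (fun θ => info a h θ i j) Θ := by
  have h2 : ContinuousOn (fderiv ℝ (fderiv ℝ h)) Θ :=
    ((hC.fderiv_of_isOpen (m := 1) hΘ (by norm_num)).fderiv_of_isOpen (m := 0) hΘ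
      (by norm_num)).continuousOn
  have hh : ∀ i j, ContinuousOn (fun θ => hessian h θ i j) Θ := fun i j =>
    (h2.clm_apply continuousOn_const).clm_apply continuousOn_const
  simp only [info, Matrix.neg_apply, Matrix.mul_apply]
  fun_prop

/-- The modulus of the observed information at radius `δ`. -/
def infoModulus (Θ : Set (E d)) (θstar : E d) (a : Mat d) (h : E d → ℝ) (δ : ℝ) : ℝ≥0∞ :=
  ⨆ u ∈ {u : E d | θstar + δ • u ∈ Θ ∧ ‖u‖ ≤ 1},
    ENNReal.ofReal ‖info a h (θstar + δ • u) - info a h θstar‖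

theorem measurable_infoModulus {Θ : Set (E d)} (hΘ : IsOpen Θ) {θstar : E d} (hθ : θstar ∈ Θ)
    {h : Ω → E d → ℝ} (hm : ∀ θ ∈ Θ, Measurable fun ω => h ω θ)
    (hC : ∀ ω, ContDiffOn ℝ 2 (h ω) Θ) (a : Mat d) (δ : ℝ) :
    Measurable fun ω => infoModulus Θ θstar a (h ω) δ := by
  refine measurable_biSup_of_continuousOn (fun u hu => ?_) fun ω => ?_
  · refine (measurable_norm_of_entries fun i j => ?_).ennreal_ofReal
    exact (measurable_info hΘ hm hC a hu.1 i j).sub (measurable_info hΘ hm hC a hθ i j)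
  · refine ENNReal.continuous_ofReal.comp_continuousOn (continuousOn_norm_of_entries fun i j => ?_)
    refine ContinuousOn.sub ?_ continuousOn_const
    exact (continuousOn_info hΘ (hC ω) a i j).comp (by fun_prop) fun u hu => hu.1

/-- The scaled distance of the contrast to its limit outside the ball of radius `rate a ^ (-α/2)`. -/
def contrastGap (Θ : Set (E d)) (θstar : E d) (a : Mat d) (h Y : E d → ℝ) (q : Params) : ℝ≥0∞ :=
  ⨆ θ ∈ Θ \ Metric.ball θstar (rate a ^ (-q.α / 2)),
    ENNReal.ofReal (rate a ^ (1 / 2 - q.β₂) * |contrast a h θstar θ - Y θ|)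

theorem measurable_contrastGap {Θ : Set (E d)} {θstar : E d} (hθ : θstar ∈ Θ)
    {h Y : Ω → E d → ℝ} (hm : ∀ θ ∈ Θ, Measurable fun ω => h ω θ)
    (hC : ∀ ω, ContinuousOn (h ω) Θ) (hYm : ∀ θ ∈ Θ, Measurable fun ω => Y ω θ)
    (hYc : ∀ ω, ContinuousOn (Y ω) Θ) (a : Mat d) (q : Params) :
    Measurable fun ω => contrastGap Θ θstar a (h ω) (Y ω) q := by
  refine measurable_biSup_of_continuousOn (fun θ hθ' => ?_) fun ω => ?_
  · have h1 := hm θ hθ'.1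
    have h2 := hm θstar hθ
    have h3 := hYm θ hθ'.1
    simp only [contrast]
    fun_prop
  · have h1 := (hC ω).mono (Set.sdiff_subset (s := Θ) (t := Metric.ball θstar (rate a ^ (-q.α / 2))))
    have h2 := (hYc ω).mono
      (Set.sdiff_subset (s := Θ) (t := Metric.ball θstar (rate a ^ (-q.α / 2))))
    refine ENNReal.continuous_ofReal.comp_continuousOn ?_
    simp only [contrast]
    fun_prop

/-- Markov's inequality for the M-th moment. The codomain is general so as to cover both vectors and
suprema valued in [0, ∞]. -/
theorem measureReal_ge_le_rpow {F : Type*} [TopologicalSpace F] [ContinuousENorm F]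
    {P : Measure Ω} [IsFiniteMeasure P] {X : Ω → F} (hX : AEStronglyMeasurable X P)
    {M K t : ℝ} (hM : 0 < M) (hK : 0 ≤ K)
    (h : eLpNorm X (ENNReal.ofReal M) P ≤ ENNReal.ofReal K) (ht : 0 < t) :
    P.real {ω | ENNReal.ofReal t ≤ ‖X ω‖ₑ} ≤ (K / t) ^ M := by
  have h1 := meas_ge_le_mul_pow_eLpNorm_enorm P (p := ENNReal.ofReal M)
    (by simpa using hM) ENNReal.ofReal_ne_top hX (ε := ENNReal.ofReal t) (by simpa using ht)
    (fun h => absurd h ENNReal.ofReal_ne_top)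
  rw [ENNReal.toReal_ofReal hM.le, ← ENNReal.mul_rpow_of_nonneg _ _ hM.le] at h1
  refine ENNReal.toReal_le_of_le_ofReal (by positivity) (h1.trans ?_)
  rw [← ENNReal.ofReal_rpow_of_nonneg (by positivity) hM.le, ENNReal.ofReal_div_of_pos ht,
    div_eq_mul_inv, mul_comm]
  gcongr

end Measurability

/-! ### Pathwise bounds away from and close to the true parameter. -/

section Deterministic

variable {d : ℕ} {Θ : Set (E d)} {θstar : E d} {h : E d → ℝ} {a : Mat d}

theorem norm_info_sub_lt_of_infoModulus_lt {δ t : ℝ} (hδ : 0 < δ)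
    (h1 : infoModulus Θ θstar a h δ < ENNReal.ofReal t) {θ : E d} (hθ : θ ∈ Θ)
    (hθδ : ‖θ - θstar‖ ≤ δ) : ‖info a h θ - info a h θstar‖ < t := by
  have hx : θstar + δ • (δ⁻¹ • (θ - θstar)) = θ := by
    rw [smul_inv_smul₀ hδ.ne']; abel
  have h2 : ENNReal.ofReal ‖info a h (θstar + δ • (δ⁻¹ • (θ - θstar))) - info a h θstar‖
      ≤ infoModulus Θ θstar a h δ := by
    refine le_iSup₂ (f := fun (u : E d) (_ : u ∈ {u : E d | θstar + δ • u ∈ Θ ∧ ‖u‖ ≤ 1}) =>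
      ENNReal.ofReal ‖info a h (θstar + δ • u) - info a h θstar‖) (δ⁻¹ • (θ - θstar)) ?_
    refine ⟨by rwa [hx], ?_⟩
    rw [norm_smul, norm_inv, Real.norm_of_nonneg hδ.le, inv_mul_le_iff₀ hδ]
    simpa using hθδ
  rw [hx] at h2
  exact (ENNReal.ofReal_lt_ofReal_iff_of_nonneg (norm_nonneg _)).1 (h2.trans_lt h1)

/-- At a point no worse than θstar the contrast is nonnegative, so the quadratic gap of Y is paid
for entirely by the deviation of the contrast from Y. -/
theorem sq_dist_le_of_contrastGap_lt {Y : E d → ℝ} {q : Params} (hb : 0 < rate a) {t χ : ℝ}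
    (ht : 0 < t)
    (hcont : ContinuousOn h (closure Θ)) {θ : E d} (hθ : θ ∈ closure Θ)
    (hfar : rate a ^ (-q.α / 2) < ‖θ - θstar‖) (hmax : h θstar ≤ h θ)
    (hY : ∀ θ ∈ Θ, Y θ ≤ -(χ * ‖θ - θstar‖ ^ 2))
    (hS : contrastGap Θ θstar a h Y q < ENNReal.ofReal t) :
    rate a ^ (1 / 2 - q.β₂) * (χ * ‖θ - θstar‖ ^ 2) ≤ t := by
  set ρ := rate a ^ (-q.α / 2)
  set k := rate a ^ (1 / 2 - q.β₂) with hk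
  have hk0 : 0 < k := Real.rpow_pos_of_pos hb _
  set U : Set (E d) := {x | ρ < ‖x - θstar‖}
  have hU : IsOpen U := isOpen_lt continuous_const (by fun_prop)
  -- The maximizer may lie on the boundary, where Y is not controlled. The strict inequality `hfar`
  -- is an open condition, so θ is a limit of far points of Θ, and the bound passes to θ through the
  -- function F, which does not involve Y.
  have hcl : θ ∈ closure (Θ ∩ U) := by
    rw [Set.inter_comm]
    exact hU.inter_closure ⟨hfar, hθ⟩
  set F : E d → ℝ := fun x => k * (contrast a h θstar x + χ * ‖x - θstar‖ ^ 2) with hF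
  have hFc : ContinuousOn F (closure Θ) := by
    simp only [hF, contrast]
    fun_prop
  have hle : ∀ x ∈ Θ ∩ U, F x ≤ t := by
    intro x hx
    have h1 : ENNReal.ofReal (k * |contrast a h θstar x - Y x|) ≤ contrastGap Θ θstar a h Y q := by
      refine le_iSup₂ (f := fun (θ : E d) (_ : θ ∈ Θ \ Metric.ball θstar ρ) =>
        ENNReal.ofReal (k * |contrast a h θstar θ - Y θ|)) x ⟨hx.1, ?_⟩
      rw [Metric.mem_ball, dist_eq_norm, not_lt]
      exact le_of_lt hx.2
    have h2 : k * |contrast a h θstar x - Y x| < t :=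
      (ENNReal.ofReal_lt_ofReal_iff ht).1 (h1.trans_lt hS)
    have h3 := hY x hx.1
    have h4 := le_abs_self (contrast a h θstar x - Y x)
    calc F x ≤ k * |contrast a h θstar x - Y x| := by
          simp only [hF]; gcongr; linarith
      _ ≤ t := h2.le
  have h5 : F θ ≤ t := by
    have hw : ContinuousWithinAt F (Θ ∩ U) θ :=
      (hFc θ hθ).mono (Set.inter_subset_left.trans subset_closure)
    exact hw.closure_le hcl continuousWithinAt_const hle
  have h6 : 0 ≤ contrast a h θstar θ :=
    mul_nonneg (inv_nonneg.2 hb.le) (sub_nonneg.2 hmax)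
  calc _ ≤ F θ := by simp only [hF]; gcongr; linarith
    _ ≤ t := h5

end Deterministic

theorem CondS1.α_lt_half {q : Params} (hq : CondS1 q) : q.α < 1 / 2 := by
  have := hq.α_lt; have := hq.sum_lt; have := hq.β₂_nonneg
  linarith

section Near

variable {d : ℕ} {Θ : Set (E d)} {θstar : E d} {h : E d → ℝ} {a : Mat d}

theorem norm_act_le_of_near (hb : 0 < rate a) {C₀ α : ℝ}
    (hbal : lambdaMax (a.transpose * a) ≤ C₀ * (rate a)⁻¹) {u : E d}
    (hu : ‖u‖ ≤ rate a ^ ((1 - α) / 2)) : ‖act a u‖ ≤ √C₀ * rate a ^ (-α / 2) := by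
  by_cases hC : 0 ≤ C₀
  · refine (pow_le_pow_iff_left₀ (norm_nonneg _) (by positivity) two_ne_zero).1 ?_
    calc ‖act a u‖ ^ 2 ≤ C₀ * (rate a)⁻¹ * ‖u‖ ^ 2 :=
          (sq_norm_act_le_lambdaMax a u).trans (by gcongr)
      _ ≤ C₀ * (rate a)⁻¹ * (rate a ^ ((1 - α) / 2)) ^ 2 := by gcongr
      _ = C₀ * ((rate a)⁻¹ * (rate a ^ ((1 - α) / 2)) ^ 2) := by ring
      _ = (√C₀ * rate a ^ (-α / 2)) ^ 2 := by
          rw [mul_pow, Real.sq_sqrt hC, ← Real.rpow_neg_one, ← Real.rpow_natCast,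
            ← Real.rpow_natCast, ← Real.rpow_mul hb.le, ← Real.rpow_mul hb.le,
            ← Real.rpow_add hb]
          congr 2
          push_cast
          ring
  -- For negative `C₀` the square root is 0 by convention, and the hypothesis forces `act a u = 0`.
  · push Not at hC
    have h1 : ‖act a u‖ ^ 2 ≤ 0 := by
      refine (sq_norm_act_le_lambdaMax a u).trans (mul_nonpos_of_nonpos_of_nonneg ?_ (sq_nonneg _))
      exact hbal.trans (mul_nonpos_of_nonpos_of_nonneg hC.le (inv_nonneg.2 hb.le))
    have h2 : ‖act a u‖ ≤ 0 := by
      nlinarith [norm_nonneg (act a u)]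
    exact h2.trans (by positivity)

theorem norm_act_sub_score_le_of_near (hΘ : IsOpen Θ) (hh : ContDiffOn ℝ 2 h Θ) {G : Mat d}
    (hG : G.IsSymm) {θ u : E d} {δ x y : ℝ} (hδ : 0 < δ)
    (hball : ∀ θ, ‖θ - θstar‖ ≤ δ → θ ∈ Θ)
    (hmax : ∀ x ∈ Θ, h x ≤ h θ) (hu : act a u = θ - θstar) (huδ : ‖act a u‖ ≤ δ)
    (hx : infoModulus Θ θstar a h δ < ENNReal.ofReal x)
    (hy : ‖info a h θstar - G‖ < y) :
    ‖act G u - score a h θstar‖ ≤ (x + y) * ‖u‖ := by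
  have hseg : ∀ z ∈ segment ℝ θstar θ, ‖z - θstar‖ ≤ δ := by
    intro z hz
    have := norm_sub_le_of_mem_segment hz
    rw [← hu] at this
    exact this.trans huδ
  refine norm_act_sub_score_le hΘ hh hG (fun z hz => hball z (hseg z hz)) hmax hu
    fun z hz => ?_
  have h1 := norm_info_sub_lt_of_infoModulus_lt hδ hx (hball z (hseg z hz)) (hseg z hz)
  calc ‖info a h z - G‖ ≤ ‖info a h z - info a h θstar‖ + ‖info a h θstar - G‖ :=
        norm_sub_le_norm_sub_add_norm_sub _ _ _
    _ ≤ x + y := by linarith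

end Near

/-! ### Tail bounds in the far and near regimes. -/

section Tail

variable {Ω : Type*} [MeasurableSpace Ω] {P : Measure Ω} [IsProbabilityMeasure P]

theorem measureReal_le_of_ae_imp {A B : Set Ω} (h : ∀ᵐ ω ∂P, ω ∈ A → ω ∈ B) :
    P.real A ≤ P.real B :=
  ENNReal.toReal_mono (measure_ne_top _ _) (measure_mono_ae h)

/-- The reason for moment orders of the form L/γ: a threshold growing like r^γ then has probability
of order r^(-L). -/
theorem div_rpow_rpow_inv {A r γ L : ℝ} (hA : 0 ≤ A) (hr : 0 < r) (hγ : 0 < γ) :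
    (A / r ^ γ) ^ (L * γ⁻¹) = A ^ (L * γ⁻¹) / r ^ L := by
  rw [Real.div_rpow hA (by positivity), ← Real.rpow_mul hr.le]
  congr 2
  field_simp

/-- In the near regime powers of b are traded for powers of r. Taking κ = α/2 and κ = β₁ produces
the exponents α/(1-α) and 2β₁/(1-α) of [S1] and [S3]. -/
theorem rpow_le_rate_rpow {b r α κ : ℝ} (hb : 0 < b) (hr : 0 < r) (hα : α < 1) (hκ : 0 ≤ κ)
    (h : r ≤ b ^ ((1 - α) / 2)) : r ^ (2 * κ / (1 - α)) ≤ b ^ κ := by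
  have h1 : 0 < 1 - α := by linarith
  calc r ^ (2 * κ / (1 - α)) ≤ (b ^ ((1 - α) / 2)) ^ (2 * κ / (1 - α)) := by gcongr
    _ = b ^ κ := by
      rw [← Real.rpow_mul hb.le]
      congr 1
      field_simp

variable {d : ℕ} {Θ : Set (E d)} {θstar : E d} {h : Ω → E d → ℝ} {a : GL (Fin d) ℝ}
  {θhat : Ω → E d} {q : Params} {L : ℝ}

/-- Tail bound for the part of the normalized error that lies outside the local neighbourhood. -/
theorem measureReal_far_le (hb : 0 < rate (a : Mat d)) (hq : CondS1 q)
    {R : ℝ} (hR : 0 < R) (hΘR : ∀ θ ∈ closure Θ, ‖θ - θstar‖ ≤ R) (hθstar : θstar ∈ Θ)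
    (hcont : ∀ ω, ContinuousOn (h ω) (closure Θ)) {Y : Ω → E d → ℝ} {χ : Ω → ℝ}
    (hχ : ∀ᵐ ω ∂P, ∀ θ ∈ Θ, Y ω θ ≤ -(χ ω * ‖θ - θstar‖ ^ 2)) {Cχ : ℝ}
    (hχC : ∀ r : ℝ, 0 < r → P.real {ω | χ ω ≤ r ^ (-(q.ρ₂ - 2 * q.α))} ≤ Cχ / r ^ L)
    {K : ℝ} (hK : 0 ≤ K) (hgap : ∀ t : ℝ, 0 < t →
      P.real {ω | ENNReal.ofReal t ≤ contrastGap Θ θstar a (h ω) (Y ω) q}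
        ≤ (K / t) ^ (L * (1 - 2 * q.β₂ - q.ρ₂)⁻¹))
    (hest : IsQMLE Θ h θhat) {r : ℝ} (hr : 0 < r) :
    P.real {ω | r ≤ ‖act (a : Mat d)⁻¹ (θhat ω - θstar)‖ ∧
        rate (a : Mat d) ^ ((1 - q.α) / 2) < ‖act (a : Mat d)⁻¹ (θhat ω - θstar)‖}
      ≤ (Cχ + (K * R ^ (1 - 2 * q.β₂ - 2 * q.α)) ^ (L * (1 - 2 * q.β₂ - q.ρ₂)⁻¹)) / r ^ L := by
  set b := rate (a : Mat d)
  set e := 1 - 2 * q.β₂ - 2 * q.α with he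
  set γ := 1 - 2 * q.β₂ - q.ρ₂ with hγ
  have hγ0 : 0 < γ := hq.sum_lt
  have he0 : 0 < e := by have := hq.α_lt; linarith
  -- Here γ is what remains of e after the factor r^(-(ρ₂-2α)) has been spent on χ, so this
  -- threshold has Markov bound of order r^(-L).
  set t := r ^ γ / R ^ e with ht
  have ht0 : 0 < t := by positivity
  have hsub : ∀ᵐ ω ∂P, ω ∈ {ω | r ≤ ‖act (a : Mat d)⁻¹ (θhat ω - θstar)‖ ∧
        b ^ ((1 - q.α) / 2) < ‖act (a : Mat d)⁻¹ (θhat ω - θstar)‖} →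
      ω ∈ {ω | χ ω ≤ r ^ (-(q.ρ₂ - 2 * q.α))} ∪
        {ω | ENNReal.ofReal t ≤ contrastGap Θ θstar a (h ω) (Y ω) q} := by
    filter_upwards [hχ] with ω hω ⟨h1, h2⟩
    by_contra hcon
    rw [Set.mem_union, not_or, Set.mem_ofPred_eq, Set.mem_ofPred_eq, not_le, not_le] at hcon
    obtain ⟨h3, h4⟩ := hcon
    set u := act (a : Mat d)⁻¹ (θhat ω - θstar) with hu
    have hau : act (a : Mat d) u = θhat ω - θstar := act_inv_act a _
    have h5 : b⁻¹ * ‖u‖ ^ 2 ≤ ‖θhat ω - θstar‖ ^ 2 := by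
      rw [← hau]; exact inv_rate_mul_sq_le _ _
    have h6 : b ^ (-q.α) < b⁻¹ * ‖u‖ ^ 2 := by
      calc b ^ (-q.α) = b⁻¹ * (b ^ ((1 - q.α) / 2)) ^ 2 := by
            rw [← Real.rpow_neg_one, ← Real.rpow_natCast, ← Real.rpow_mul hb.le,
              ← Real.rpow_add hb]
            congr 1
            push_cast
            ring
        _ < b⁻¹ * ‖u‖ ^ 2 := by gcongr
    have h7 : b ^ (-q.α / 2) < ‖θhat ω - θstar‖ := by
      refine lt_of_pow_lt_pow_left₀ 2 (norm_nonneg _) ?_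
      calc (b ^ (-q.α / 2)) ^ 2 = b ^ (-q.α) := by
            rw [← Real.rpow_natCast, ← Real.rpow_mul hb.le]
            congr 1
            push_cast
            ring
        _ < _ := h6.trans_le h5
    have h8 := sq_dist_le_of_contrastGap_lt hb ht0 (hcont ω) (hest.mem_closure ω) h7
      (hest.isMax ω θstar (subset_closure hθstar)) hω h4
    -- Boundedness of Θ converts r into a lower bound on b, since r ≤ |u| ≤ √b · R.
    have hbr : (r / R) ^ 2 ≤ b := by
      have h9 := hΘR _ (hest.mem_closure ω)
      have h10 : r ^ 2 ≤ b * R ^ 2 := by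
        have h11 : b⁻¹ * r ^ 2 ≤ R ^ 2 := by
          calc b⁻¹ * r ^ 2 ≤ b⁻¹ * ‖u‖ ^ 2 := by gcongr
            _ ≤ ‖θhat ω - θstar‖ ^ 2 := h5
            _ ≤ R ^ 2 := by gcongr
        rwa [inv_mul_le_iff₀ hb] at h11
      rw [div_pow, div_le_iff₀ (by positivity)]
      exact h10
    have h12 : (r / R) ^ e ≤ b ^ (e / 2) := by
      calc (r / R) ^ e = ((r / R) ^ 2) ^ (e / 2) := by
            rw [← Real.rpow_natCast, ← Real.rpow_mul (by positivity)]
            congr 1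
            push_cast
            ring
        _ ≤ b ^ (e / 2) := by gcongr
    have h13 : t = (r / R) ^ e * r ^ (-(q.ρ₂ - 2 * q.α)) := by
      rw [ht, Real.div_rpow hr.le hR.le, div_mul_eq_mul_div, ← Real.rpow_add hr]
      congr 2
      rw [hγ, he]; ring
    have h14 : b ^ (1 / 2 - q.β₂) * b ^ (-q.α) = b ^ (e / 2) := by
      rw [← Real.rpow_add hb]
      congr 1
      rw [he]; ring
    have h15 : t < b ^ (1 / 2 - q.β₂) * (χ ω * ‖θhat ω - θstar‖ ^ 2) := by
      have hp : 0 < r ^ (-(q.ρ₂ - 2 * q.α)) := by positivity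
      calc t ≤ b ^ (e / 2) * r ^ (-(q.ρ₂ - 2 * q.α)) := by rw [h13]; gcongr
        _ = b ^ (1 / 2 - q.β₂) * (r ^ (-(q.ρ₂ - 2 * q.α)) * b ^ (-q.α)) := by
            rw [← h14]; ring
        _ < b ^ (1 / 2 - q.β₂) * (χ ω * ‖θhat ω - θstar‖ ^ 2) := by
            refine mul_lt_mul_of_pos_left ?_ (by positivity)
            exact mul_lt_mul'' h3 (h6.trans_le h5) hp.le (by positivity)
    linarith
  refine (measureReal_le_of_ae_imp hsub).trans ((measureReal_union_le _ _).trans ?_)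
  rw [add_div]
  refine add_le_add (hχC r hr) ((hgap t ht0).trans (le_of_eq ?_))
  rw [ht, div_div_eq_mul_div, div_rpow_rpow_inv (by positivity) hr hγ0]

/-- Tail bound for the part of the normalized error that lies in the local neighbourhood. -/
theorem measureReal_near_le (hb : 0 < rate (a : Mat d)) (hq : CondS1 q) (hΘ : IsOpen Θ)
    (hC2 : ∀ ω, ContDiffOn ℝ 2 (h ω) Θ) {C₀ : ℝ} (hC₀ : 1 ≤ C₀)
    (hbal : lambdaMax ((a : Mat d).transpose * (a : Mat d)) ≤ C₀ * (rate (a : Mat d))⁻¹)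
    {δ : ℝ} (hδ : δ = √C₀ * rate (a : Mat d) ^ (-q.α / 2))
    (hball : ∀ θ, ‖θ - θstar‖ ≤ δ → θ ∈ Θ)
    {Γ : Ω → Mat d} (hΓ : ∀ ω, (Γ ω).IsSymm) {CΓ K₁ K₃ K₄ : ℝ} (hK₁ : 0 ≤ K₁) (hK₃ : 0 ≤ K₃)
    (hK₄ : 0 ≤ K₄)
    (hΓC : ∀ r : ℝ, 0 < r → P.real {ω | lambdaMin (Γ ω) < r ^ (-q.ρ₁)} ≤ CΓ / r ^ L)
    (hscore : ∀ t : ℝ, 0 < t → P.real {ω | t ≤ ‖score a (h ω) θstar‖}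
      ≤ (K₁ / t) ^ (L * (1 - q.ρ₁)⁻¹))
    (hmod : ∀ t : ℝ, 0 < t → P.real {ω | ENNReal.ofReal t ≤ infoModulus Θ θstar a (h ω) δ}
      ≤ (K₃ * δ / t) ^ (L * (q.α / (1 - q.α) - q.ρ₁)⁻¹))
    (hinfo : ∀ t : ℝ, 0 < t →
      P.real {ω | t ≤ rate (a : Mat d) ^ q.β₁ * ‖info a (h ω) θstar - Γ ω‖}
      ≤ (K₄ / t) ^ (L * (2 * q.β₁ * (1 - q.α)⁻¹ - q.ρ₁)⁻¹))
    (hest : IsQMLE Θ h θhat) (hL : 0 < L) {r : ℝ} (hr : 0 < r) :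
    P.real {ω | r ≤ ‖act (a : Mat d)⁻¹ (θhat ω - θstar)‖ ∧
        ‖act (a : Mat d)⁻¹ (θhat ω - θstar)‖ ≤ rate (a : Mat d) ^ ((1 - q.α) / 2)}
      ≤ (CΓ + (3 * K₁) ^ (L * (1 - q.ρ₁)⁻¹)
          + (3 * K₃ * √C₀) ^ (L * (q.α / (1 - q.α) - q.ρ₁)⁻¹)
          + (3 * K₄) ^ (L * (2 * q.β₁ * (1 - q.α)⁻¹ - q.ρ₁)⁻¹)) / r ^ L := by
  set b := rate (a : Mat d)
  have hα0 : 0 < q.α := by have := hq.α_pos; linarith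
  have hα1 : q.α < 1 := by have := hq.α_lt_half; linarith
  have hρ := hq.ρ₁_lt
  rw [lt_min_iff, lt_min_iff] at hρ
  obtain ⟨hρ1, hρ2, hρ3⟩ := hρ
  rw [div_eq_mul_inv (2 * q.β₁)] at hρ3
  have hγ1 : 0 < 1 - q.ρ₁ := by linarith
  have hγ3 : 0 < q.α / (1 - q.α) - q.ρ₁ := by linarith
  have hγ4 : 0 < 2 * q.β₁ * (1 - q.α)⁻¹ - q.ρ₁ := by linarith
  have hδ0 : 0 < δ := by rw [hδ]; positivity
  -- For larger r the event is empty, and only nonnegativity of the constant is needed; `CΓ` is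
  -- nonnegative by its tail bound at r = 1.
  by_cases hrb : r ≤ b ^ ((1 - q.α) / 2)
  swap
  · have hempty : {ω | r ≤ ‖act (a : Mat d)⁻¹ (θhat ω - θstar)‖ ∧
        ‖act (a : Mat d)⁻¹ (θhat ω - θstar)‖ ≤ b ^ ((1 - q.α) / 2)} = ∅ := by
      ext ω
      simp only [Set.mem_ofPred_eq, Set.mem_empty_iff_false, iff_false, not_and]
      intro h1 h2
      exact hrb (h1.trans h2)
    rw [hempty, measureReal_empty]
    have : 0 ≤ CΓ := by
      have := (measureReal_nonneg).trans (hΓC 1 one_pos)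
      simpa using this
    positivity
  -- The lower bound 3x on λ_min(Γ) is shared by three errors: the oscillation of the information,
  -- its distance from Γ, and the score.
  set x := r ^ (-q.ρ₁) / 3 with hx
  have hx0 : 0 < x := by positivity
  set A := {ω | r ≤ ‖act (a : Mat d)⁻¹ (θhat ω - θstar)‖ ∧
        ‖act (a : Mat d)⁻¹ (θhat ω - θstar)‖ ≤ b ^ ((1 - q.α) / 2)}
  have hsub : A ⊆ {ω | lambdaMin (Γ ω) < r ^ (-q.ρ₁)} ∪ {ω | x * r ≤ ‖score a (h ω) θstar‖}
      ∪ {ω | ENNReal.ofReal x ≤ infoModulus Θ θstar a (h ω) δ}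
      ∪ {ω | b ^ q.β₁ * x ≤ b ^ q.β₁ * ‖info a (h ω) θstar - Γ ω‖} := by
    rintro ω ⟨h1, h2⟩
    by_contra hcon
    simp only [Set.mem_union, not_or, Set.mem_ofPred_eq, not_le, not_lt] at hcon
    obtain ⟨⟨⟨h3, h4⟩, h5⟩, h6⟩ := hcon
    have h6' : ‖info a (h ω) θstar - Γ ω‖ < x := lt_of_mul_lt_mul_left h6 (by positivity)
    set u := act (a : Mat d)⁻¹ (θhat ω - θstar) with hu
    have hau : act (a : Mat d) u = θhat ω - θstar := act_inv_act a _
    have hu0 : 0 < ‖u‖ := hr.trans_le h1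
    have h7 := norm_act_sub_score_le_of_near hΘ (hC2 ω) (hΓ ω) hδ0 hball
      (fun z hz => hest.isMax ω z (subset_closure hz)) hau
      (hδ ▸ norm_act_le_of_near hb hbal h2) h5 h6'
    have h8 := lambdaMin_mul_sq_le (hΓ ω) u
    have h9 : inner ℝ u (act (Γ ω) u) ≤ ‖u‖ * ((x + x) * ‖u‖ + ‖score a (h ω) θstar‖) := by
      refine (real_inner_le_norm _ _).trans ?_
      gcongr
      have := norm_sub_norm_le (act (Γ ω) u) (score a (h ω) θstar)
      linarith
    have h10 : r ^ (-q.ρ₁) * ‖u‖ ^ 2 ≤ lambdaMin (Γ ω) * ‖u‖ ^ 2 := by gcongr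
    have h11 : r ^ (-q.ρ₁) = 3 * x := by rw [hx]; ring
    have h12 : ‖score a (h ω) θstar‖ < x * ‖u‖ := h4.trans_le (by gcongr)
    have h13 : ‖u‖ * ‖score a (h ω) θstar‖ < ‖u‖ * (x * ‖u‖) := by gcongr
    rw [h11] at h10
    nlinarith
  refine (measureReal_mono hsub).trans ?_
  refine (measureReal_union_le _ _).trans ?_
  rw [add_div _ _ (r ^ L)]
  refine add_le_add ?_ ?_
  · refine (measureReal_union_le _ _).trans ?_
    rw [add_div _ _ (r ^ L)]
    refine add_le_add ?_ ?_
    · refine (measureReal_union_le _ _).trans ?_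
      rw [add_div _ _ (r ^ L)]
      refine add_le_add (hΓC r hr) ?_
      refine (hscore _ (by positivity)).trans (le_of_eq ?_)
      rw [← div_rpow_rpow_inv (by positivity) hr hγ1]
      congr 1
      rw [hx, sub_eq_neg_add, Real.rpow_add hr, Real.rpow_one]
      field_simp
    · refine (hmod _ hx0).trans ?_
      rw [← div_rpow_rpow_inv (by positivity) hr hγ3]
      refine Real.rpow_le_rpow (by positivity) ?_ (by positivity)
      have h1 := rpow_le_rate_rpow (κ := q.α / 2) hb hr hα1 (by positivity) hrb
      rw [show 2 * (q.α / 2) / (1 - q.α) = q.α / (1 - q.α) by ring] at h1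
      rw [hx, hδ, neg_div, Real.rpow_neg hb.le, Real.rpow_neg hr.le, Real.rpow_sub hr]
      have h2 : 0 < r ^ (q.α / (1 - q.α)) := by positivity
      calc K₃ * (√C₀ * (b ^ (q.α / 2))⁻¹) / ((r ^ q.ρ₁)⁻¹ / 3)
          = 3 * K₃ * √C₀ * r ^ q.ρ₁ * (b ^ (q.α / 2))⁻¹ := by field_simp
        _ ≤ 3 * K₃ * √C₀ * r ^ q.ρ₁ * (r ^ (q.α / (1 - q.α)))⁻¹ := by gcongr
        _ = _ := by field_simp
  · refine (hinfo _ (by positivity)).trans ?_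
    rw [← div_rpow_rpow_inv (by positivity) hr hγ4]
    refine Real.rpow_le_rpow (by positivity) ?_ (by positivity)
    have h1 := rpow_le_rate_rpow (κ := q.β₁) hb hr hα1 hq.β₁_pos.le hrb
    rw [div_eq_mul_inv (2 * q.β₁)] at h1
    rw [hx, Real.rpow_neg hr.le, Real.rpow_sub hr]
    have h2 : 0 < r ^ (2 * q.β₁ * (1 - q.α)⁻¹) := by positivity
    calc K₄ / (b ^ q.β₁ * ((r ^ q.ρ₁)⁻¹ / 3))
        = 3 * K₄ * r ^ q.ρ₁ * (b ^ q.β₁)⁻¹ := by field_simp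
      _ ≤ 3 * K₄ * r ^ q.ρ₁ * (r ^ (2 * q.β₁ * (1 - q.α)⁻¹))⁻¹ := by gcongr
      _ = _ := by field_simp

end Tail

/-- The standing assumptions on the random fields, the scaling matrices and the estimators, for a
family indexed by `ι` with `l` the direction in which `a` vanishes. -/
structure Setting {Ω : Type*} [MeasurableSpace Ω] (P : Measure Ω) {d : ℕ} {ι : Type*}
    (l : Filter ι) (q : Params) (L C₀ : ℝ) (Θ : Set (E d)) (θstar : E d)
    (a : ι → GL (Fin d) ℝ) (H : ι → Ω → E d → ℝ) (Y : Ω → E d → ℝ) (Γ : Ω → Mat d)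
    (θhat : ι → Ω → E d) : Prop where
  dim_pos : 0 < d
  isOpen : IsOpen Θ
  isBounded : Bornology.IsBounded Θ
  mem : θstar ∈ Θ
  field_meas : ∀ T, ∀ θ ∈ Θ, Measurable fun ω => H T ω θ
  field_C2 : ∀ T ω, ContDiffOn ℝ 2 (H T ω) Θ
  field_cont : ∀ T ω, ContinuousOn (H T ω) (closure Θ)
  tendsto_zero : Tendsto (fun T => ‖(a T : Mat d)‖) l (𝓝 0)
  one_le : 1 ≤ C₀
  balanced : ∀ T, lambdaMax ((a T : Mat d).transpose * (a T : Mat d)) ≤ C₀ * (rate (a T : Mat d))⁻¹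
  limit_meas : ∀ θ ∈ Θ, Measurable fun ω => Y ω θ
  limit_cont : ∀ ω, ContinuousOn (Y ω) Θ
  info_symm : ∀ ω, (Γ ω).IsSymm
  info_meas : ∀ i j, Measurable fun ω => Γ ω i j
  L_pos : 0 < L
  condS1 : CondS1 q
  condS2 : CondS2 P q L Θ θstar Y Γ
  condS3 : CondS3 P q L Θ θstar (fun T => (a T : Mat d)) H Y Γ
  score_meas : ∀ T, AEMeasurable (fun ω => score (a T : Mat d) (H T ω) θstar) P
  est : ∀ T, IsQMLE Θ (H T) (θhat T)

theorem exists_real_bound_of_iSup_lt_top {ι : Type*} {f : ι → ℝ≥0∞} (h : ⨆ i, f i < ∞) :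
    ∃ K : ℝ, 0 ≤ K ∧ ∀ i, f i ≤ ENNReal.ofReal K :=
  ⟨(⨆ i, f i).toReal, ENNReal.toReal_nonneg, fun i => by
    rw [ENNReal.ofReal_toReal h.ne]; exact le_iSup f i⟩

/-! ### Consequences of [S1]-[S3]: the uniform tail bound and claim (a). -/

namespace Setting

variable {Ω : Type*} [MeasurableSpace Ω] {P : Measure Ω} {d : ℕ}
  {ι : Type*} {l : Filter ι} {q : Params} {L C₀ : ℝ} {Θ : Set (E d)} {θstar : E d}
  {a : ι → GL (Fin d) ℝ} {H : ι → Ω → E d → ℝ} {Y : Ω → E d → ℝ} {Γ : Ω → Mat d}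
  {θhat : ι → Ω → E d}

theorem rate_pos (S : Setting P l q L C₀ Θ θstar a H Y Γ θhat) (T : ι) :
    0 < rate (a T : Mat d) := QLA.rate_pos S.dim_pos (a T)

theorem tendsto_rate (S : Setting P l q L C₀ Θ θstar a H Y Γ θhat) :
    Tendsto (fun T => rate (a T : Mat d)) l atTop := by
  have h1 : Tendsto (fun T => (rate (a T : Mat d))⁻¹) l (𝓝[>] 0) := by
    refine tendsto_nhdsWithin_iff.2 ⟨?_, Eventually.of_forall fun T => inv_pos.2 (S.rate_pos T)⟩
    have h2 : Tendsto (fun T => ‖(a T : Mat d)‖ ^ 2) l (𝓝 0) := by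
      simpa using S.tendsto_zero.pow 2
    exact squeeze_zero (fun T => (inv_pos.2 (S.rate_pos T)).le)
      (fun T => inv_rate_le_sq_norm S.dim_pos _) h2
  exact h1.inv_tendsto_nhdsGT_zero.congr fun T => inv_inv _

/-- The radius of the local neighbourhood in the original scale. -/
abbrev radius (a : ι → GL (Fin d) ℝ) (C₀ : ℝ) (q : Params) (T : ι) : ℝ :=
  √C₀ * rate (a T : Mat d) ^ (-q.α / 2)

theorem tendsto_radius (S : Setting P l q L C₀ Θ θstar a H Y Γ θhat) :
    Tendsto (radius a C₀ q) l (𝓝[>] 0) := by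
  have hα : 0 < q.α / 2 := by have := S.condS1.α_pos; linarith
  have hC : 0 < √C₀ := Real.sqrt_pos.2 (by linarith [S.one_le])
  refine tendsto_nhdsWithin_iff.2 ⟨?_, Eventually.of_forall fun T =>
    mul_pos hC (Real.rpow_pos_of_pos (S.rate_pos T) _)⟩
  have h1 := ((tendsto_rpow_neg_atTop hα).comp S.tendsto_rate).const_mul √C₀
  rw [mul_zero] at h1
  exact h1.congr fun T => by simp [radius, neg_div]

theorem exponents_pos (S : Setting P l q L C₀ Θ θstar a H Y Γ θhat) :
    0 < L * (1 - q.ρ₁)⁻¹ ∧ 0 < L * (1 - 2 * q.β₂ - q.ρ₂)⁻¹ ∧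
      0 < L * (q.α / (1 - q.α) - q.ρ₁)⁻¹ ∧ 0 < L * (2 * q.β₁ * (1 - q.α)⁻¹ - q.ρ₁)⁻¹ := by
  have hρ := S.condS1.ρ₁_lt
  rw [lt_min_iff, lt_min_iff] at hρ
  obtain ⟨h1, h2, h3⟩ := hρ
  rw [div_eq_mul_inv (2 * q.β₁)] at h3
  exact ⟨mul_pos S.L_pos (inv_pos.2 (sub_pos.2 h1)), mul_pos S.L_pos (inv_pos.2 S.condS1.sum_lt),
    mul_pos S.L_pos (inv_pos.2 (sub_pos.2 h2)), mul_pos S.L_pos (inv_pos.2 (sub_pos.2 h3))⟩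

theorem eventually_ball_subset (S : Setting P l q L C₀ Θ θstar a H Y Γ θhat) :
    ∀ᶠ T in l, ∀ θ, ‖θ - θstar‖ ≤ radius a C₀ q T → θ ∈ Θ := by
  obtain ⟨ε, hε, hball⟩ := Metric.isOpen_iff.1 S.isOpen θstar S.mem
  filter_upwards [(tendsto_nhds_of_tendsto_nhdsWithin S.tendsto_radius).eventually
    (gt_mem_nhds hε)] with T hT θ hθ
  exact hball (by rw [Metric.mem_ball, dist_eq_norm]; exact hθ.trans_lt hT)

theorem exists_radius_bound (S : Setting P l q L C₀ Θ θstar a H Y Γ θhat) :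
    ∃ R : ℝ, 0 < R ∧ ∀ θ ∈ closure Θ, ‖θ - θstar‖ ≤ R := by
  obtain ⟨R, hR⟩ := S.isBounded.closure.subset_closedBall θstar
  refine ⟨max R 1, lt_max_of_lt_right one_pos, fun θ hθ => ?_⟩
  have := hR hθ
  rw [Metric.mem_closedBall, dist_eq_norm] at this
  exact this.trans (le_max_left _ _)

/-- The bound depends on T. It gives integrability at every single T, whereas the tail bound holds
only eventually. -/
theorem exists_error_bound (S : Setting P l q L C₀ Θ θstar a H Y Γ θhat) (T : ι) :
    ∃ R : ℝ, ∀ ω, ‖act (a T : Mat d)⁻¹ (θhat T ω - θstar)‖ ≤ R := by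
  obtain ⟨R, -, hR⟩ := S.exists_radius_bound
  exact ⟨‖(a T : Mat d)⁻¹‖ * R, fun ω => (norm_act_le _ _).trans
    (mul_le_mul_of_nonneg_left (hR _ ((S.est T).mem_closure ω)) (norm_nonneg _))⟩

variable [IsProbabilityMeasure P]

theorem exists_score_tail (S : Setting P l q L C₀ Θ θstar a H Y Γ θhat) :
    ∃ K : ℝ, 0 ≤ K ∧ ∀ T, ∀ t : ℝ, 0 < t →
      P.real {ω | t ≤ ‖score (a T : Mat d) (H T ω) θstar‖} ≤ (K / t) ^ (L * (1 - q.ρ₁)⁻¹) := by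
  obtain ⟨K, hK, h⟩ := exists_real_bound_of_iSup_lt_top S.condS3.score_moment
  refine ⟨K, hK, fun T t ht => ?_⟩
  have := measureReal_ge_le_rpow (S.score_meas T).aestronglyMeasurable S.exponents_pos.1 hK (h T) ht
  simpa only [← ofReal_norm, ENNReal.ofReal_le_ofReal_iff (norm_nonneg _)] using this

theorem tight_score (S : Setting P l q L C₀ Θ θstar a H Y Γ θhat) (ε : ℝ) (hε : 0 < ε) :
    ∃ R : ℝ, 0 < R ∧ ∀ T, P.real {ω | R ≤ ‖score (a T : Mat d) (H T ω) θstar‖} ≤ ε := by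
  obtain ⟨K, -, h⟩ := S.exists_score_tail
  have h1 : Tendsto (fun t : ℝ => (K / t) ^ (L * (1 - q.ρ₁)⁻¹)) atTop (𝓝 0) := by
    have h2 := (tendsto_id.const_div_atTop K).rpow_const (Or.inr S.exponents_pos.1.le)
    rwa [Real.zero_rpow S.exponents_pos.1.ne'] at h2
  obtain ⟨R, hR, hR0⟩ := ((h1.eventually (gt_mem_nhds hε)).and (eventually_gt_atTop 0)).exists
  exact ⟨R, hR0, fun T => (h T R hR0).trans hR.le⟩

theorem exists_gap_tail (S : Setting P l q L C₀ Θ θstar a H Y Γ θhat) :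
    ∃ K : ℝ, 0 ≤ K ∧ ∀ T, ∀ t : ℝ, 0 < t →
      P.real {ω | ENNReal.ofReal t ≤ contrastGap Θ θstar (a T : Mat d) (H T ω) (Y ω) q}
        ≤ (K / t) ^ (L * (1 - 2 * q.β₂ - q.ρ₂)⁻¹) := by
  obtain ⟨K, hK, h⟩ := exists_real_bound_of_iSup_lt_top S.condS3.contrast_moment
  refine ⟨K, hK, fun T t ht => ?_⟩
  have hm := measurable_contrastGap S.mem (S.field_meas T)
    (fun ω => (S.field_cont T ω).mono subset_closure) S.limit_meas S.limit_cont (a T : Mat d) q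
  simpa using measureReal_ge_le_rpow (P := P) hm.aestronglyMeasurable S.exponents_pos.2.1 hK (h T) ht

theorem exists_modulus_tail (S : Setting P l q L C₀ Θ θstar a H Y Γ θhat) :
    ∃ K : ℝ, 0 ≤ K ∧ ∀ᶠ T in l, ∀ t : ℝ, 0 < t →
      P.real {ω | ENNReal.ofReal t ≤ infoModulus Θ θstar (a T : Mat d) (H T ω) (radius a C₀ q T)}
        ≤ (K * radius a C₀ q T / t) ^ (L * (q.α / (1 - q.α) - q.ρ₁)⁻¹) := by
  obtain ⟨C, hC⟩ := S.condS3.info_modulus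
  refine ⟨max C 0, le_max_right _ _, ?_⟩
  filter_upwards [S.tendsto_radius.eventually hC,
    S.tendsto_radius.eventually self_mem_nhdsWithin] with T hT hT0 t ht
  have hδ : 0 < radius a C₀ q T := hT0
  have hm := measurable_infoModulus S.isOpen S.mem (S.field_meas T) (S.field_C2 T) (a T : Mat d)
    (radius a C₀ q T)
  -- The radius of T is frozen as δ, and the supremum over all indices at that δ dominates its term
  -- at T.
  have h1 : eLpNorm (fun ω => infoModulus Θ θstar (a T : Mat d) (H T ω) (radius a C₀ q T))
      (ENNReal.ofReal (L * (q.α / (1 - q.α) - q.ρ₁)⁻¹)) P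
        ≤ ENNReal.ofReal (max C 0 * radius a C₀ q T) := by
    refine le_trans ?_ (hT.trans (ENNReal.ofReal_le_ofReal
      (mul_le_mul_of_nonneg_right (le_max_left _ _) hδ.le)))
    exact le_iSup (fun T' => eLpNorm
      (fun ω => infoModulus Θ θstar (a T' : Mat d) (H T' ω) (radius a C₀ q T))
      (ENNReal.ofReal (L * (q.α / (1 - q.α) - q.ρ₁)⁻¹)) P) T
  simpa using measureReal_ge_le_rpow (P := P) hm.aestronglyMeasurable S.exponents_pos.2.2.1
    (mul_nonneg (le_max_right _ _) hδ.le) h1 ht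

theorem exists_info_tail (S : Setting P l q L C₀ Θ θstar a H Y Γ θhat) :
    ∃ K : ℝ, 0 ≤ K ∧ ∀ T, ∀ t : ℝ, 0 < t →
      P.real {ω | t ≤ rate (a T : Mat d) ^ q.β₁ * ‖info (a T : Mat d) (H T ω) θstar - Γ ω‖}
        ≤ (K / t) ^ (L * (2 * q.β₁ * (1 - q.α)⁻¹ - q.ρ₁)⁻¹) := by
  obtain ⟨K, hK, h⟩ := exists_real_bound_of_iSup_lt_top S.condS3.info_moment
  refine ⟨K, hK, fun T t ht => ?_⟩
  have hm : Measurable fun ω =>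
      rate (a T : Mat d) ^ q.β₁ * ‖info (a T : Mat d) (H T ω) θstar - Γ ω‖ := by
    refine (measurable_norm_of_entries fun i j => ?_).const_mul _
    exact (measurable_info S.isOpen (S.field_meas T) (S.field_C2 T) (a T : Mat d) S.mem i j).sub
      (S.info_meas i j)
  have := measureReal_ge_le_rpow (P := P) hm.aestronglyMeasurable S.exponents_pos.2.2.2 hK (h T) ht
  refine le_trans (measureReal_mono fun ω hω => ?_) this
  rw [Set.mem_ofPred_eq] at hω ⊢
  rw [Real.enorm_of_nonneg (mul_nonneg (Real.rpow_nonneg (S.rate_pos T).le _) (norm_nonneg _))]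
  exact ENNReal.ofReal_le_ofReal hω

/-- The polynomial tail bound for the normalized estimation error. -/
theorem exists_error_tail (S : Setting P l q L C₀ Θ θstar a H Y Γ θhat) :
    ∃ C : ℝ, ∀ᶠ T in l, ∀ r : ℝ, 0 < r →
      P.real {ω | r ≤ ‖act (a T : Mat d)⁻¹ (θhat T ω - θstar)‖} ≤ C / r ^ L := by
  obtain ⟨K₁, hK₁, h₁⟩ := S.exists_score_tail
  obtain ⟨K₂, hK₂, h₂⟩ := S.exists_gap_tail
  obtain ⟨K₃, hK₃, h₃⟩ := S.exists_modulus_tail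
  obtain ⟨K₄, hK₄, h₄⟩ := S.exists_info_tail
  obtain ⟨CΓ, hΓ⟩ := S.condS2.nondegeneracy
  obtain ⟨χ, -, -, hχ, Cχ, hχC⟩ := S.condS2.identifiability
  obtain ⟨R, hR, hΘR⟩ := S.exists_radius_bound
  refine ⟨(Cχ + (K₂ * R ^ (1 - 2 * q.β₂ - 2 * q.α)) ^ (L * (1 - 2 * q.β₂ - q.ρ₂)⁻¹)) +
    (CΓ + (3 * K₁) ^ (L * (1 - q.ρ₁)⁻¹)
          + (3 * K₃ * √C₀) ^ (L * (q.α / (1 - q.α) - q.ρ₁)⁻¹)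
          + (3 * K₄) ^ (L * (2 * q.β₁ * (1 - q.α)⁻¹ - q.ρ₁)⁻¹)), ?_⟩
  filter_upwards [h₃, S.eventually_ball_subset] with T hT hball r hr
  have hχ' : ∀ᵐ ω ∂P, ∀ θ ∈ Θ, Y ω θ ≤ -(χ ω * ‖θ - θstar‖ ^ 2) := by
    filter_upwards [hχ] with ω hω θ hθ
    rw [(hω θ hθ).1]
    exact (hω θ hθ).2
  have hfar := measureReal_far_le (S.rate_pos T) S.condS1 hR hΘR S.mem (S.field_cont T) hχ' hχC hK₂
    (h₂ T) (S.est T) hr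
  have hnear := measureReal_near_le (S.rate_pos T) S.condS1 S.isOpen (S.field_C2 T) S.one_le
    (S.balanced T) rfl hball S.info_symm hK₁ hK₃ hK₄ hΓ (h₁ T) hT (h₄ T) (S.est T) S.L_pos hr
  rw [add_div]
  refine le_trans (measureReal_mono fun ω hω => ?_) ((measureReal_union_le _ _).trans
    (add_le_add hfar hnear))
  rw [Set.mem_union]
  rcases lt_or_ge (rate (a T : Mat d) ^ ((1 - q.α) / 2))
    ‖act (a T : Mat d)⁻¹ (θhat T ω - θstar)‖ with h | h
  · exact Or.inl ⟨hω, h⟩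
  · exact Or.inr ⟨hω, h⟩

theorem tendsto_modulus (S : Setting P l q L C₀ Θ θstar a H Y Γ θhat) {x : ℝ} (hx : 0 < x) :
    Tendsto (fun T => P.real {ω | ENNReal.ofReal x
      ≤ infoModulus Θ θstar (a T : Mat d) (H T ω) (radius a C₀ q T)}) l (𝓝 0) := by
  obtain ⟨K, -, h⟩ := S.exists_modulus_tail
  refine squeeze_zero' (Eventually.of_forall fun T => measureReal_nonneg)
    (h.mono fun T hT => hT x hx) ?_
  have h1 : Tendsto (fun T => K * radius a C₀ q T / x) l (𝓝 0) := by
    simpa using ((tendsto_nhds_of_tendsto_nhdsWithin S.tendsto_radius).const_mul K).div_const x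
  simpa [Real.zero_rpow S.exponents_pos.2.2.1.ne'] using
    h1.rpow_const (Or.inr S.exponents_pos.2.2.1.le)

theorem tendsto_info (S : Setting P l q L C₀ Θ θstar a H Y Γ θhat) {x : ℝ} (hx : 0 < x) :
    Tendsto (fun T => P.real {ω | x ≤ ‖info (a T : Mat d) (H T ω) θstar - Γ ω‖}) l (𝓝 0) := by
  obtain ⟨K, -, h⟩ := S.exists_info_tail
  have hpos : ∀ T, 0 < rate (a T : Mat d) ^ q.β₁ := fun T => Real.rpow_pos_of_pos (S.rate_pos T) _
  have h1 : Tendsto (fun T => K / (rate (a T : Mat d) ^ q.β₁ * x)) l (𝓝 0) :=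
    (((tendsto_rpow_atTop S.condS1.β₁_pos).comp S.tendsto_rate).atTop_mul_const hx).const_div_atTop
      K
  have h2 := h1.rpow_const (p := L * (2 * q.β₁ * (1 - q.α)⁻¹ - q.ρ₁)⁻¹)
    (Or.inr S.exponents_pos.2.2.2.le)
  rw [Real.zero_rpow S.exponents_pos.2.2.2.ne'] at h2
  refine squeeze_zero (fun T => measureReal_nonneg) (fun T => ?_) h2
  refine le_trans (measureReal_mono fun ω hω => ?_) (h T _ (mul_pos (hpos T) hx))
  exact mul_le_mul_of_nonneg_left hω (hpos T).le

/-- The tail bound is applied at r = b^((1-α)/2), which tends to infinity; the near regime thus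
carries all the mass in the limit. -/
theorem tendsto_far (S : Setting P l q L C₀ Θ θstar a H Y Γ θhat) :
    Tendsto (fun T => P.real {ω | rate (a T : Mat d) ^ ((1 - q.α) / 2)
      ≤ ‖act (a T : Mat d)⁻¹ (θhat T ω - θstar)‖}) l (𝓝 0) := by
  obtain ⟨C, hC⟩ := S.exists_error_tail
  have hα : 0 < (1 - q.α) / 2 := by have := S.condS1.α_lt_half; linarith
  refine squeeze_zero' (Eventually.of_forall fun T => measureReal_nonneg)
    (hC.mono fun T hT => hT _ (Real.rpow_pos_of_pos (S.rate_pos T) _)) ?_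
  exact ((tendsto_rpow_atTop S.L_pos).comp
    ((tendsto_rpow_atTop hα).comp S.tendsto_rate)).const_div_atTop C

/-- The estimation error is asymptotically the score transformed by the inverse information. -/
theorem tendstoInMeasure (S : Setting P l q L C₀ Θ θstar a H Y Γ θhat) :
    TendstoInMeasure P
      (fun T ω => act (a T : Mat d)⁻¹ (θhat T ω - θstar)
        - act (Γ ω)⁻¹ (score (a T : Mat d) (H T ω) θstar)) l (fun _ => 0) := by
  rw [tendstoInMeasure_iff_measureReal_norm]
  intro ε hε
  obtain ⟨C, hC⟩ := S.exists_error_tail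
  obtain ⟨CΓ, hΓ⟩ := S.condS2.nondegeneracy
  rw [tendsto_order]
  refine ⟨fun η hη => Eventually.of_forall fun T => hη.trans_le measureReal_nonneg,
    fun η hη => ?_⟩
  -- First r makes the two nonvanishing bad events small, uniformly in large T; x then depends on r
  -- and ε, and the other three events vanish as T grows.
  have hr : ∃ r : ℝ, 0 < r ∧ CΓ / r ^ L + C / r ^ L < η := by
    have h1 : Tendsto (fun r : ℝ => CΓ / r ^ L + C / r ^ L) atTop (𝓝 0) := by
      simpa using ((tendsto_rpow_atTop S.L_pos).const_div_atTop CΓ).add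
        ((tendsto_rpow_atTop S.L_pos).const_div_atTop C)
    obtain ⟨r, h2, h3⟩ := ((h1.eventually (gt_mem_nhds hη)).and (eventually_gt_atTop 0)).exists
    exact ⟨r, h3, h2⟩
  obtain ⟨r, hr, hrη⟩ := hr
  -- Calibrated so that (x + x) r = r^(-ρ₁) ε/2, which yields ‖w‖ ≤ ε/2.
  set x := r ^ (-q.ρ₁) * ε / (4 * r) with hx
  have hx0 : 0 < x := by positivity
  have hlim := (((tendsto_const_nhds (x := CΓ / r ^ L + C / r ^ L)).add S.tendsto_far).add
    (S.tendsto_modulus hx0)).add (S.tendsto_info hx0)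
  simp only [add_zero] at hlim
  filter_upwards [hC, S.eventually_ball_subset, hlim.eventually (gt_mem_nhds hrη),
    S.tendsto_radius.eventually self_mem_nhdsWithin] with T hT hball hlt hδ
  refine lt_of_le_of_lt ?_ hlt
  have hsub : {ω | ε ≤ ‖act (a T : Mat d)⁻¹ (θhat T ω - θstar)
        - act (Γ ω)⁻¹ (score (a T : Mat d) (H T ω) θstar) - 0‖} ⊆
      {ω | lambdaMin (Γ ω) < r ^ (-q.ρ₁)}
      ∪ {ω | r ≤ ‖act (a T : Mat d)⁻¹ (θhat T ω - θstar)‖}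
      ∪ {ω | rate (a T : Mat d) ^ ((1 - q.α) / 2) ≤ ‖act (a T : Mat d)⁻¹ (θhat T ω - θstar)‖}
      ∪ {ω | ENNReal.ofReal x ≤ infoModulus Θ θstar (a T : Mat d) (H T ω) (radius a C₀ q T)}
      ∪ {ω | x ≤ ‖info (a T : Mat d) (H T ω) θstar - Γ ω‖} := by
    intro ω hω
    rw [Set.mem_ofPred_eq, sub_zero] at hω
    by_contra hcon
    simp only [Set.mem_union, not_or, Set.mem_ofPred_eq, not_le, not_lt] at hcon
    obtain ⟨⟨⟨⟨h1, h2⟩, h3⟩, h4⟩, h5⟩ := hcon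
    set u := act (a T : Mat d)⁻¹ (θhat T ω - θstar) with hu
    have hau : act (a T : Mat d) u = θhat T ω - θstar := act_inv_act (a T) _
    set w := u - act (Γ ω)⁻¹ (score (a T : Mat d) (H T ω) θstar) with hw
    have hlam : 0 < r ^ (-q.ρ₁) := by positivity
    have hunit := isUnit_of_lambdaMin_pos (S.info_symm ω) (hlam.trans_le h1)
    have hGw : act (Γ ω) w = act (Γ ω) u - score (a T : Mat d) (H T ω) θstar := by
      rw [hw, act_sub, ← act_mul (Γ ω) (Γ ω)⁻¹,
        Matrix.mul_nonsing_inv _ ((Matrix.isUnit_iff_isUnit_det _).1 hunit), act_one]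
    have h7 := norm_act_sub_score_le_of_near S.isOpen (S.field_C2 T ω) (S.info_symm ω) hδ hball
      (fun z hz => (S.est T).isMax ω z (subset_closure hz)) hau
      (norm_act_le_of_near (S.rate_pos T) (S.balanced T) h3.le) h4 h5
    rw [← hGw] at h7
    have hw0 : 0 < ‖w‖ := hε.trans_le hω
    have h8 : r ^ (-q.ρ₁) * ‖w‖ ^ 2 ≤ ‖w‖ * ‖act (Γ ω) w‖ :=
      ((mul_le_mul_of_nonneg_right h1 (sq_nonneg _)).trans
        (lambdaMin_mul_sq_le (S.info_symm ω) w)).trans (real_inner_le_norm _ _)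
    have h9 : r ^ (-q.ρ₁) * ‖w‖ ≤ (x + x) * ‖u‖ := by
      refine le_trans (le_of_mul_le_mul_left ?_ hw0) h7
      calc ‖w‖ * (r ^ (-q.ρ₁) * ‖w‖) = r ^ (-q.ρ₁) * ‖w‖ ^ 2 := by ring
        _ ≤ _ := h8
    have h10 : (x + x) * ‖u‖ ≤ (x + x) * r := by gcongr
    have h11 : (x + x) * r = r ^ (-q.ρ₁) * (ε / 2) := by
      rw [hx]; field_simp; ring
    have h12 : ‖w‖ ≤ ε / 2 := le_of_mul_le_mul_left (by linarith) hlam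
    linarith
  refine (measureReal_mono hsub).trans ?_
  refine (measureReal_union_le _ _).trans (add_le_add ?_ le_rfl)
  refine (measureReal_union_le _ _).trans (add_le_add ?_ le_rfl)
  refine (measureReal_union_le _ _).trans (add_le_add ?_ le_rfl)
  exact (measureReal_union_le _ _).trans (add_le_add (hΓ r hr) (hT r hr))

end Setting

/-! ### Random matrices treated entrywise. -/

section RandomMatrices

variable {d : ℕ} {Ω : Type*}

theorem measurable_det_of_entries {m : MeasurableSpace Ω} {A : Ω → Mat d}
    (hA : ∀ i j, Measurable fun ω => A ω i j) : Measurable fun ω => (A ω).det := by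
  simp only [Matrix.det_apply]
  fun_prop

/-- By Cramer's rule the entries are rational in those of A; singular matrices are covered by the
convention that the inverse is 0. The σ-field is left free so that 𝒢 can be used. -/
theorem measurable_inv_of_entries {m : MeasurableSpace Ω} {A : Ω → Mat d}
    (hA : ∀ i j, Measurable fun ω => A ω i j) (i j : Fin d) :
    Measurable fun ω => (A ω)⁻¹ i j := by
  simp only [Matrix.inv_def, Matrix.smul_apply, Ring.inverse_eq_inv', smul_eq_mul,
    Matrix.adjugate_apply]
  refine (measurable_det_of_entries hA).inv.mul (measurable_det_of_entries fun k k' => ?_)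
  simp only [Matrix.updateRow_apply]
  split_ifs
  · exact measurable_const
  · exact hA k k'

theorem aemeasurable_act {m : MeasurableSpace Ω} {P : Measure Ω} {A : Ω → Mat d} {V : Ω → E d}
    (hA : ∀ i j, Measurable fun ω => A ω i j) (hV : AEMeasurable V P) :
    AEMeasurable (fun ω => act (A ω) (V ω)) P := by
  have h : AEMeasurable (fun ω => WithLp.toLp 2 fun i => ∑ j, A ω i j * V ω j) P := by
    refine (WithLp.measurable_toLp 2 _).comp_aemeasurable (aemeasurable_pi_iff.2 fun i => ?_)
    refine Finset.aemeasurable_fun_sum _ fun j _ => (hA i j).aemeasurable.mul ?_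
    exact (by fun_prop : Measurable fun x : E d => x j).comp_aemeasurable hV
  refine h.congr (Eventually.of_forall fun ω => ?_)
  ext i
  simp [act_apply]

theorem measurable_of_entry {m : MeasurableSpace Ω} {s : Ω → Fin d → Fin d → ℝ}
    (hs : Measurable s) (i j : Fin d) : Measurable fun ω => Matrix.of (s ω) i j :=
  measurable_pi_iff.1 (measurable_pi_iff.1 hs i) j

theorem continuous_norm_of_sub (B : Mat d) :
    Continuous fun x : Fin d → Fin d → ℝ => ‖Matrix.of x - B‖ := by
  simp only [norm_eq_sqrt_sum, Matrix.sub_apply, Matrix.of_apply]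
  fun_prop

end RandomMatrices

theorem exists_finite_range_approx {Ω : Type*} [MeasurableSpace Ω] {X : Type*}
    [PseudoMetricSpace X] [SecondCountableTopology X] [MeasurableSpace X] [BorelSpace X]
    {B : Ω → X} (hB : Measurable B) :
    ∃ s : ℕ → Ω → X, (∀ n, (Set.range (s n)).Finite) ∧ (∀ n, Measurable (s n)) ∧
      ∀ ω, Tendsto (fun n => s n ω) atTop (𝓝 (B ω)) :=
  ⟨fun n => hB.stronglyMeasurable.approx n, fun _ => SimpleFunc.finite_range _,
    fun _ => SimpleFunc.measurable _, hB.stronglyMeasurable.tendsto_approx⟩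

/-! ### Comparison of weighted integrals of two nearby vectors. -/

section WeightedIntegrals

variable {Ω : Type*} [MeasurableSpace Ω] {P : Measure Ω} [IsProbabilityMeasure P]

theorem integrable_mul_of_bounded {f Φ : Ω → ℝ} (hf : AEStronglyMeasurable f P)
    (hΦ : AEStronglyMeasurable Φ P) {M K : ℝ} (hfM : ∀ ω, |f ω| ≤ M) (hΦK : ∀ ω, |Φ ω| ≤ K) :
    Integrable (fun ω => f ω * Φ ω) P := by
  refine Integrable.of_bound (hf.mul hΦ) (M * K) (Eventually.of_forall fun ω => ?_)
  rw [norm_mul]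
  exact mul_le_mul (hfM ω) (hΦK ω) (norm_nonneg _) ((abs_nonneg _).trans (hfM ω))

/-- Where the vectors are δ-close the modulus of continuity gives ε; elsewhere the crude bound 2M is
used. -/
theorem abs_integral_mul_sub_le {F : Type*} [NormedAddCommGroup F] [MeasurableSpace F]
    [BorelSpace F] [SecondCountableTopology F]
    {g : F → ℝ} (hg : Continuous g) {M K ε δ : ℝ} (hgM : ∀ x, |g x| ≤ M)
    (hε : 0 ≤ ε) (hgδ : ∀ x y, ‖x - y‖ < δ → |g x - g y| ≤ ε) {X X' : Ω → F}
    (hX : AEMeasurable X P) (hX' : AEMeasurable X' P) {Φ : Ω → ℝ}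
    (hΦ : AEStronglyMeasurable Φ P) (hΦK : ∀ ω, |Φ ω| ≤ K) :
    |∫ ω, g (X ω) * Φ ω ∂P - ∫ ω, g (X' ω) * Φ ω ∂P|
      ≤ K * (ε + 2 * M * P.real {ω | δ ≤ ‖X ω - X' ω‖}) := by
  have hK : 0 ≤ K := by
    obtain ⟨ω⟩ : Nonempty Ω := P.nonempty_of_neZero
    exact (abs_nonneg _).trans (hΦK ω)
  have hM : 0 ≤ M := (abs_nonneg _).trans (hgM 0)
  have hi := integrable_mul_of_bounded (hg.comp_aestronglyMeasurable hX.aestronglyMeasurable) hΦ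
    (fun ω => hgM (X ω)) hΦK
  have hi' := integrable_mul_of_bounded (hg.comp_aestronglyMeasurable hX'.aestronglyMeasurable) hΦ
    (fun ω => hgM (X' ω)) hΦK
  set A : Set Ω := {ω | δ ≤ ‖X ω - X' ω‖} with hA
  have hAm : NullMeasurableSet A P :=
    nullMeasurableSet_le aemeasurable_const (hX.sub hX').norm
  have hind : Integrable (A.indicator fun _ => (1 : ℝ)) P :=
    (integrable_const (1 : ℝ)).indicator₀ hAm
  rw [← integral_sub hi hi']
  have hb : ∀ ω, ‖g (X ω) * Φ ω - g (X' ω) * Φ ω‖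
      ≤ K * (ε + 2 * M * A.indicator (fun _ => (1 : ℝ)) ω) := by
    intro ω
    rw [← sub_mul, norm_mul, mul_comm K]
    refine mul_le_mul ?_ (hΦK ω) (norm_nonneg _) ?_
    · by_cases h : ω ∈ A
      · rw [Set.indicator_of_mem h]
        have h1 := abs_sub (g (X ω)) (g (X' ω))
        have h2 := hgM (X ω)
        have h3 := hgM (X' ω)
        rw [Real.norm_eq_abs]
        linarith
      · rw [Set.indicator_of_notMem h, mul_zero, add_zero]
        exact hgδ _ _ (not_le.1 h)
    · have : 0 ≤ A.indicator (fun _ => (1 : ℝ)) ω :=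
        Set.indicator_nonneg (fun _ _ => zero_le_one) ω
      positivity
  refine (norm_integral_le_of_norm_le (((integrable_const ε).add (hind.const_mul (2 * M))).const_mul K)
    (Eventually.of_forall hb)).trans (le_of_eq ?_)
  simp only [Pi.add_apply]
  rw [integral_const_mul, integral_add (integrable_const _) (hind.const_mul _),
    integral_const_mul, integral_indicator₀ hAm]
  simp

end WeightedIntegrals

/-! ### Stable convergence under random linear maps. -/

section Stable

variable {Ω Ω' : Type*} {𝒢 : MeasurableSpace Ω} [mΩ : MeasurableSpace Ω] [MeasurableSpace Ω']
  {P : Measure Ω} [IsProbabilityMeasure P] {P' : Measure Ω'} [IsProbabilityMeasure P']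
  {π : Ω' → Ω} {d : ℕ} {ι : Type*} {V : ι → Ω → E d} {l : Filter ι} {V' : Ω' → E d}

/-- Convergence in law includes measurability of the converging pair, so a constant Ψ suffices. -/
theorem StableTendsto.aemeasurable (h : StableTendsto 𝒢 P P' π V l V') (T : ι) :
    AEMeasurable (V T) P :=
  ((h (fun _ => 0) measurable_const).forall_aemeasurable T).fst

theorem StableTendsto.tendsto_integral (h : StableTendsto 𝒢 P P' π V l V') {g : E d → ℝ}
    (hg : Continuous g) {M : ℝ} (hgM : ∀ x, |g x| ≤ M) {Φ : Ω → ℝ} (hΦ : Measurable[𝒢] Φ)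
    {K : ℝ} (hΦK : ∀ ω, |Φ ω| ≤ K) :
    Tendsto (fun T => ∫ ω, g (V T ω) * Φ ω ∂P) l (𝓝 (∫ ω', g (V' ω') * Φ (π ω') ∂P')) := by
  have hK : 0 ≤ K := by
    obtain ⟨ω⟩ : Nonempty Ω := P.nonempty_of_neZero
    exact (abs_nonneg _).trans (hΦK ω)
  have hM : 0 ≤ M := (abs_nonneg _).trans (hgM 0)
  have hcl : ∀ y : ℝ, |max (-K) (min K y)| ≤ K := fun y =>
    abs_le.2 ⟨le_max_left _ _, max_le (by linarith) (min_le_left _ _)⟩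
  have hclΦ : ∀ ω, max (-K) (min K (Φ ω)) = Φ ω := fun ω => by
    have := abs_le.1 (hΦK ω)
    rw [min_eq_right this.2, max_eq_right this.1]
  -- The product g(v)y is unbounded in y; clamping y to [-K, K] makes it bounded and leaves the
  -- values of Φ unchanged.
  let G : BoundedContinuousFunction (E d × ℝ) ℝ := BoundedContinuousFunction.ofNormedAddCommGroup
    (fun z => g z.1 * max (-K) (min K z.2)) (by fun_prop) (M * K) (fun z => by
      rw [norm_mul]
      exact mul_le_mul (hgM _) (hcl _) (norm_nonneg _) hM)
  have hΦ' := h Φ hΦ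
  have h1 := (ProbabilityMeasure.tendsto_iff_forall_integral_tendsto.1 hΦ'.tendsto) G
  have h2 : ∀ T, ∫ z, G z ∂(P.map fun ω => (V T ω, Φ ω)) = ∫ ω, g (V T ω) * Φ ω ∂P := fun T => by
    rw [integral_map (hΦ'.forall_aemeasurable T) G.continuous.aestronglyMeasurable]
    refine integral_congr_ae (Eventually.of_forall fun ω => ?_)
    simp [G, hclΦ]
  have h3 : ∫ z, G z ∂(P'.map fun ω' => (V' ω', Φ (π ω'))) = ∫ ω', g (V' ω') * Φ (π ω') ∂P' := by
    rw [integral_map hΦ'.aemeasurable_limit G.continuous.aestronglyMeasurable]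
    refine integral_congr_ae (Eventually.of_forall fun ω => ?_)
    simp [G, hclΦ]
  simp only [ProbabilityMeasure.coe_mk, h2, h3] at h1
  exact h1

theorem StableTendsto.tendsto_integral_act_of_finite_range (h : StableTendsto 𝒢 P P' π V l V')
    (h𝒢 : 𝒢 ≤ mΩ) (hπ : Measurable π) (hV' : AEMeasurable V' P')
    {g : E d → ℝ} (hg : Continuous g) {M : ℝ} (hgM : ∀ x, |g x| ≤ M) {Φ : Ω → ℝ}
    (hΦ : Measurable[𝒢] Φ) {K : ℝ} (hΦK : ∀ ω, |Φ ω| ≤ K)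
    {s : Ω → Fin d → Fin d → ℝ} (hsf : (Set.range s).Finite) (hs : Measurable[𝒢] s) :
    Tendsto (fun T => ∫ ω, g (act (Matrix.of (s ω)) (V T ω)) * Φ ω ∂P) l
      (𝓝 (∫ ω', g (act (Matrix.of (s (π ω'))) (V' ω')) * Φ (π ω') ∂P')) := by
  classical
  -- Stability is available only for real weights. On each level set of `s` the matrix is constant,
  -- so the level set can be absorbed into the weight.
  let Ψ : (Fin d → Fin d → ℝ) → Ω → ℝ := fun x => (s ⁻¹' {x}).indicator Φ
  have hΨm : ∀ x, Measurable[𝒢] (Ψ x) := fun x => hΦ.indicator (hs (measurableSet_singleton x))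
  have hΨK : ∀ x ω, |Ψ x ω| ≤ K := by
    intro x ω
    by_cases hx : ω ∈ s ⁻¹' {x}
    · simpa [Ψ, Set.indicator_of_mem hx] using hΦK ω
    · simpa [Ψ, Set.indicator_of_notMem hx] using (abs_nonneg _).trans (hΦK ω)
  have hsum : ∀ ω v, g (act (Matrix.of (s ω)) v) * Φ ω
      = ∑ x ∈ hsf.toFinset, g (act (Matrix.of x) v) * Ψ x ω := by
    intro ω v
    rw [Finset.sum_eq_single (s ω)]
    · simp [Ψ]
    · intro x _ hx
      have : ω ∉ s ⁻¹' {x} := fun hmem => hx (by simpa using hmem.symm)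
      simp [Ψ, Set.indicator_of_notMem this]
    · intro hmem
      exact absurd (hsf.mem_toFinset.2 (Set.mem_range_self ω)) hmem
  have hgx : ∀ x : Fin d → Fin d → ℝ, Continuous fun v => g (act (Matrix.of x) v) :=
    fun x => hg.comp (continuous_act _)
  have hlim := tendsto_finsetSum hsf.toFinset fun x _ =>
    h.tendsto_integral (hgx x) (fun v => hgM _) (hΨm x) (hΨK x)
  have e1 : ∀ T, ∫ ω, g (act (Matrix.of (s ω)) (V T ω)) * Φ ω ∂P
      = ∑ x ∈ hsf.toFinset, ∫ ω, g (act (Matrix.of x) (V T ω)) * Ψ x ω ∂P := fun T => by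
    simp only [hsum]
    refine integral_finsetSum _ fun x _ => integrable_mul_of_bounded ?_ ?_ (fun ω => hgM _) (hΨK x)
    · exact (hgx x).comp_aestronglyMeasurable (h.aemeasurable T).aestronglyMeasurable
    · exact ((hΨm x).mono h𝒢 le_rfl).aestronglyMeasurable
  have e2 : ∫ ω', g (act (Matrix.of (s (π ω'))) (V' ω')) * Φ (π ω') ∂P'
      = ∑ x ∈ hsf.toFinset, ∫ ω', g (act (Matrix.of x) (V' ω')) * Ψ x (π ω') ∂P' := by
    simp only [hsum]
    refine integral_finsetSum _ fun x _ => integrable_mul_of_bounded ?_ ?_ (fun ω => hgM _)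
      (fun ω' => hΨK x (π ω'))
    · exact (hgx x).comp_aestronglyMeasurable hV'.aestronglyMeasurable
    · exact (((hΨm x).mono h𝒢 le_rfl).comp hπ).aestronglyMeasurable
  rw [e2]
  exact hlim.congr fun T => (e1 T).symm

/-- Stable convergence passes to a random linear image. -/
theorem StableTendsto.tendsto_integral_act (h : StableTendsto 𝒢 P P' π V l V')
    (h𝒢 : 𝒢 ≤ mΩ) (hπ : Measurable π) (hV' : AEMeasurable V' P')
    (htight : ∀ ε : ℝ, 0 < ε → ∃ R : ℝ, 0 < R ∧ ∀ T, P.real {ω | R ≤ ‖V T ω‖} ≤ ε)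
    {B : Ω → Mat d} (hB : ∀ i j, Measurable[𝒢] fun ω => B ω i j)
    {g : E d → ℝ} (hg : UniformContinuous g) {M : ℝ} (hgM : ∀ x, |g x| ≤ M) {Φ : Ω → ℝ}
    (hΦ : Measurable[𝒢] Φ) {K : ℝ} (hΦK : ∀ ω, |Φ ω| ≤ K) :
    Tendsto (fun T => ∫ ω, g (act (B ω) (V T ω)) * Φ ω ∂P) l
      (𝓝 (∫ ω', g (act (B (π ω')) (V' ω')) * Φ (π ω') ∂P')) := by
  wlog hMK : 0 < M ∧ 0 < K generalizing M K
  · exact this (M := max M 1) (K := max K 1) (fun x => (hgM x).trans (le_max_left _ _))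
      (fun ω => (hΦK ω).trans (le_max_left _ _))
      ⟨lt_max_of_lt_right one_pos, lt_max_of_lt_right one_pos⟩
  obtain ⟨hM, hK⟩ := hMK
  have hBm : Measurable[𝒢] fun ω => (fun i j => B ω i j : Fin d → Fin d → ℝ) :=
    @measurable_pi_lambda _ _ _ 𝒢 _ _ fun i => @measurable_pi_lambda _ _ _ 𝒢 _ _ fun j => hB i j
  obtain ⟨s, hsf, hsm, hs⟩ := @exists_finite_range_approx Ω 𝒢 _ _ _ _ _ _ hBm
  have hsmeas : ∀ n i j, Measurable[𝒢] fun ω => Matrix.of (s n ω) i j := fun n i j =>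
    measurable_of_entry (hsm n) i j
  have hN : ∀ ω, Tendsto (fun n => ‖Matrix.of (s n ω) - B ω‖) atTop (𝓝 0) := fun ω => by
    have h1 := ((continuous_norm_of_sub (B ω)).tendsto _).comp (hs ω)
    have h2 : Matrix.of (fun i j => B ω i j) - B ω = 0 := sub_self _
    rw [h2, norm_zero] at h1
    exact h1
  have hNP : ∀ x : ℝ, 0 < x →
      Tendsto (fun n => P.real {ω | x ≤ ‖Matrix.of (s n ω) - B ω‖}) atTop (𝓝 0) := by
    intro x hx
    have hm : ∀ n, AEStronglyMeasurable (fun ω => ‖Matrix.of (s n ω) - B ω‖) P := fun n =>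
      (measurable_norm_of_entries fun i j => ((hsmeas n i j).mono h𝒢 le_rfl).sub
        ((hB i j).mono h𝒢 le_rfl)).aestronglyMeasurable
    have h1 := tendstoInMeasure_of_tendsto_ae hm (Eventually.of_forall hN)
    rw [tendstoInMeasure_iff_measureReal_norm] at h1
    simpa using h1 x hx
  -- Interchange of the limits in n and T: tightness makes the approximation of B uniform in T, and
  -- dominated convergence handles the limit side.
  refine TendstoUniformly.tendsto_of_eventually_tendsto
    (F := fun n T => ∫ ω, g (act (Matrix.of (s n ω)) (V T ω)) * Φ ω ∂P) (p := atTop)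
    (L := fun n => ∫ ω', g (act (Matrix.of (s n (π ω'))) (V' ω')) * Φ (π ω') ∂P') ?_
    (Eventually.of_forall fun n => h.tendsto_integral_act_of_finite_range h𝒢 hπ hV' hg.continuous hgM
      hΦ hΦK (hsf n) (hsm n)) ?_
  · rw [Metric.tendstoUniformly_iff]
    intro ε hε
    obtain ⟨δ, hδ, hgδ⟩ := Metric.uniformContinuous_iff.1 hg (ε / (4 * K)) (by positivity)
    obtain ⟨R, hR, hRT⟩ := htight (ε / (8 * K * M)) (by positivity)
    filter_upwards [(hNP (δ / R) (by positivity)).eventually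
      (gt_mem_nhds (show 0 < ε / (8 * K * M) by positivity))] with n hn T
    have hVm := h.aemeasurable T
    have h1 := abs_integral_mul_sub_le (P := P) hg.continuous (ε := ε / (4 * K)) (δ := δ) hgM
      (by positivity)
      (fun x y hxy => (hgδ (by rwa [dist_eq_norm])).le)
      (aemeasurable_act (fun i j => (hB i j).mono h𝒢 le_rfl) hVm)
      (aemeasurable_act (fun i j => (hsmeas n i j).mono h𝒢 le_rfl) hVm)
      (hΦ.mono h𝒢 le_rfl).aestronglyMeasurable hΦK
    rw [Real.dist_eq]
    have h2 : P.real {ω | δ ≤ ‖act (B ω) (V T ω) - act (Matrix.of (s n ω)) (V T ω)‖}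
        ≤ ε / (8 * K * M) + ε / (8 * K * M) := by
      refine le_trans (measureReal_mono ?_) ((measureReal_union_le _ _).trans
        (add_le_add (hRT T) hn.le))
      intro ω hω
      by_contra hcon
      simp only [Set.mem_union, not_or, Set.mem_ofPred_eq, not_le] at hcon hω
      rw [← act_sub_left] at hω
      have h3 := norm_act_le (B ω - Matrix.of (s n ω)) (V T ω)
      rw [norm_sub_rev] at h3
      have h4 : ‖Matrix.of (s n ω) - B ω‖ * ‖V T ω‖ < δ / R * R :=
        mul_lt_mul'' hcon.2 hcon.1 (norm_nonneg _) (norm_nonneg _)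
      rw [div_mul_cancel₀ _ hR.ne'] at h4
      linarith
    calc _ ≤ _ := h1
      _ ≤ K * (ε / (4 * K) + 2 * M * (ε / (8 * K * M) + ε / (8 * K * M))) := by gcongr
      _ = 3 / 4 * ε := by field_simp; ring
      _ < ε := by linarith
  · have hΦπ : Measurable fun ω' => Φ (π ω') := (hΦ.mono h𝒢 le_rfl).comp hπ
    refine tendsto_integral_of_dominated_convergence (fun _ => M * K) (fun n => ?_)
      (integrable_const _) (fun n => Eventually.of_forall fun ω' => ?_)
      (Eventually.of_forall fun ω' => ?_)
    · refine AEStronglyMeasurable.mul (hg.continuous.comp_aestronglyMeasurable ?_)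
        hΦπ.aestronglyMeasurable
      exact (aemeasurable_act (A := fun ω' => Matrix.of (s n (π ω')))
        (fun i j => ((hsmeas n i j).mono h𝒢 le_rfl).comp hπ) hV').aestronglyMeasurable
    · rw [norm_mul]
      exact mul_le_mul (hgM _) (hΦK _) (norm_nonneg _) hM.le
    · refine Tendsto.mul_const _ ((hg.continuous.tendsto _).comp ?_)
      rw [tendsto_iff_norm_sub_tendsto_zero]
      refine squeeze_zero (fun n => norm_nonneg _) (fun n => ?_)
        (by simpa using (hN (π ω')).mul_const ‖V' ω'‖)
      rw [← act_sub_left]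
      exact norm_act_le _ _

end Stable

/-! ### Truncation of functions of polynomial growth. -/

section Cutoff

variable {d : ℕ}

/-- A continuous cutoff, equal to one on the ball of radius `n` and to zero outside the ball of
radius `n + 1`. -/
def cutoff (n : ℕ) (u : E d) : ℝ := max 0 (min 1 (n + 1 - ‖u‖))

theorem continuous_cutoff (n : ℕ) : Continuous (cutoff n : E d → ℝ) := by
  unfold cutoff; fun_prop

theorem cutoff_nonneg (n : ℕ) (u : E d) : 0 ≤ cutoff n u := le_max_left _ _

theorem cutoff_le_one (n : ℕ) (u : E d) : cutoff n u ≤ 1 :=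
  max_le zero_le_one (min_le_left _ _)

theorem cutoff_eq_one {n : ℕ} {u : E d} (h : ‖u‖ ≤ n) : cutoff n u = 1 := by
  rw [cutoff, min_eq_left (by linarith), max_eq_right zero_le_one]

theorem cutoff_eq_zero {n : ℕ} {u : E d} (h : n + 1 ≤ ‖u‖) : cutoff n u = 0 := by
  rw [cutoff, max_eq_left]
  exact (min_le_right _ _).trans (by linarith)

theorem hasCompactSupport_mul_cutoff (f : E d → ℝ) (n : ℕ) :
    HasCompactSupport fun u => f u * cutoff n u := by
  refine HasCompactSupport.intro (isCompact_closedBall (0 : E d) (n + 1)) fun u hu => ?_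
  rw [Metric.mem_closedBall, dist_zero_right, not_le] at hu
  rw [cutoff_eq_zero hu.le, mul_zero]

theorem tendsto_mul_cutoff (f : E d → ℝ) (u : E d) :
    Tendsto (fun n => f u * cutoff n u) atTop (𝓝 (f u)) := by
  refine tendsto_const_nhds.congr' ?_
  filter_upwards [eventually_ge_atTop ⌈‖u‖⌉₊] with n hn
  rw [cutoff_eq_one ((Nat.le_ceil _).trans (by exact_mod_cast hn)), mul_one]

theorem exists_growth_bound {f : E d → ℝ} (hf : Continuous f) {p : ℝ}
    (hfp : f =O[Bornology.cobounded (E d)] fun u => ‖u‖ ^ p) :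
    ∃ A : ℝ, 0 ≤ A ∧ ∀ u, |f u| ≤ A * (1 + ‖u‖ ^ p) := by
  obtain ⟨c, hc⟩ := hfp.bound
  rw [← comap_norm_atTop, eventually_comap] at hc
  obtain ⟨R, hR⟩ := eventually_atTop.1 hc
  obtain ⟨M, hM⟩ := (isCompact_closedBall (0 : E d) R).exists_bound_of_continuousOn hf.continuousOn
  refine ⟨max (max c M) 0, le_max_right _ _, fun u => ?_⟩
  have hp : 0 ≤ ‖u‖ ^ p := by positivity
  rcases le_total ‖u‖ R with h | h
  · have h1 := hM u (by simpa using h)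
    have h2 : M ≤ max (max c M) 0 := (le_max_right _ _).trans (le_max_left _ _)
    rw [Real.norm_eq_abs] at h1
    nlinarith [le_max_right (max c M) (0 : ℝ)]
  · have h1 := hR _ h u rfl
    rw [Real.norm_eq_abs, Real.norm_of_nonneg hp] at h1
    have h2 : c ≤ max (max c M) 0 := (le_max_left _ _).trans (le_max_left _ _)
    nlinarith [le_max_right (max c M) (0 : ℝ), mul_le_mul_of_nonneg_right h2 hp]

/-- The error lives on ‖u‖ > n ≥ 1, where ‖u‖^p = ‖u‖^(p-s) ‖u‖^s and p - s < 0; the spare exponent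
provides the decay in n. -/
theorem abs_sub_mul_cutoff_le {f : E d → ℝ} {A p s : ℝ} (hA : 0 ≤ A) (hp : 0 < p) (hps : p < s)
    (hf : ∀ u, |f u| ≤ A * (1 + ‖u‖ ^ p)) {n : ℕ} (hn : 1 ≤ n) (u : E d) :
    |f u - f u * cutoff n u| ≤ 2 * A * (n : ℝ) ^ (p - s) * ‖u‖ ^ s := by
  rcases le_or_gt ‖u‖ n with h | h
  · rw [cutoff_eq_one h, mul_one, sub_self, abs_zero]
    positivity
  · have hn1 : (1 : ℝ) ≤ n := by exact_mod_cast hn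
    have hu1 : 1 ≤ ‖u‖ := hn1.trans h.le
    have hu0 : 0 < ‖u‖ := one_pos.trans_le hu1
    have h1 : |f u - f u * cutoff n u| ≤ |f u| := by
      rw [show f u - f u * cutoff n u = f u * (1 - cutoff n u) by ring, abs_mul]
      refine mul_le_of_le_one_right (abs_nonneg _) (abs_le.2 ⟨?_, ?_⟩)
      · linarith [cutoff_le_one n u]
      · linarith [cutoff_nonneg n u]
    have h2 : 1 ≤ ‖u‖ ^ p := Real.one_le_rpow hu1 hp.le
    have h3 : ‖u‖ ^ p = ‖u‖ ^ (p - s) * ‖u‖ ^ s := by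
      rw [← Real.rpow_add hu0]; congr 1; ring
    have h4 : ‖u‖ ^ (p - s) ≤ (n : ℝ) ^ (p - s) :=
      Real.rpow_le_rpow_of_nonpos (one_pos.trans_le hn1) h.le (by linarith)
    calc |f u - f u * cutoff n u| ≤ A * (1 + ‖u‖ ^ p) := h1.trans (hf u)
      _ ≤ A * (2 * ‖u‖ ^ p) := by gcongr; linarith
      _ = 2 * A * ‖u‖ ^ (p - s) * ‖u‖ ^ s := by rw [h3]; ring
      _ ≤ _ := by gcongr

end Cutoff

/-! ### Moments from tails. -/

section Moments

variable {Ω : Type*} [MeasurableSpace Ω] {P : Measure Ω} [IsProbabilityMeasure P]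

/-- A tail of order `L` bounds all moments of order less than `L`, uniformly. -/
theorem exists_moment_bound {s L : ℝ} (hs : 0 < s) (hsL : s < L) (C : ℝ) :
    ∃ K : ℝ, 0 ≤ K ∧ ∀ X : Ω → ℝ, (∀ ω, 0 ≤ X ω) → AEMeasurable X P →
      (∀ r : ℝ, 0 < r → P.real {ω | r ≤ X ω} ≤ C / r ^ L) →
      ∫⁻ ω, ENNReal.ofReal (X ω ^ s) ∂P ≤ ENNReal.ofReal K := by
  have hI1 : IntegrableOn (fun t : ℝ => t ^ (s - 1)) (Set.Ioc 0 1) := by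
    rw [← intervalIntegrable_iff_integrableOn_Ioc_of_le zero_le_one]
    exact intervalIntegral.intervalIntegrable_rpow' (by linarith)
  have hI2 : IntegrableOn (fun t : ℝ => C * t ^ (s - 1 - L)) (Set.Ioi 1) :=
    (integrableOn_Ioi_rpow_of_lt (by linarith) one_pos).const_mul C
  -- Layer-cake integral, with probabilities bounded by 1 up to t = 1 and by the tail beyond. It
  -- does not involve X, hence the uniformity.
  set J : ℝ≥0∞ := ENNReal.ofReal s * ((∫⁻ t in Set.Ioc (0 : ℝ) 1, ENNReal.ofReal (t ^ (s - 1))) +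
    ∫⁻ t in Set.Ioi (1 : ℝ), ENNReal.ofReal (C * t ^ (s - 1 - L))) with hJ
  have hJtop : J ≠ ∞ := by
    refine ENNReal.mul_ne_top ENNReal.ofReal_ne_top (ENNReal.add_ne_top.2 ⟨?_, ?_⟩)
    · exact hI1.lintegral_lt_top.ne
    · exact hI2.lintegral_lt_top.ne
  refine ⟨J.toReal, ENNReal.toReal_nonneg, fun X hX hXm hXr => ?_⟩
  rw [ENNReal.ofReal_toReal hJtop,
    lintegral_rpow_eq_lintegral_meas_le_mul P (Eventually.of_forall hX) hXm hs, hJ]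
  gcongr
  rw [← Set.Ioc_union_Ioi_eq_Ioi (zero_le_one' ℝ),
    lintegral_union measurableSet_Ioi (Set.Ioc_disjoint_Ioi le_rfl)]
  refine add_le_add (lintegral_mono fun t => ?_) (setLIntegral_mono' measurableSet_Ioi fun t ht => ?_)
  · exact mul_le_of_le_one_left zero_le prob_le_one
  · have ht0 : (0 : ℝ) < t := one_pos.trans ht
    rw [← ofReal_measureReal, ← ENNReal.ofReal_mul measureReal_nonneg]
    refine ENNReal.ofReal_le_ofReal ?_
    calc P.real {ω | t ≤ X ω} * t ^ (s - 1) ≤ C / t ^ L * t ^ (s - 1) := by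
          gcongr; exact hXr t ht0
      _ = C * t ^ (s - 1 - L) := by rw [Real.rpow_sub ht0 (s - 1) L]; ring

end Moments

/-! ### Convergence of expectations, from compact support to polynomial growth. -/

section Convergence

variable {Ω Ω' : Type*} {𝒢 : MeasurableSpace Ω} [mΩ : MeasurableSpace Ω] [MeasurableSpace Ω']
  {P : Measure Ω} [IsProbabilityMeasure P] {P' : Measure Ω'} [IsProbabilityMeasure P']
  {π : Ω' → Ω} {d : ℕ} {ι : Type*} {V U : ι → Ω → E d} {l : Filter ι} {V' : Ω' → E d}
  {B : Ω → Mat d}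

theorem StableTendsto.tendsto_integral_of_tendstoInMeasure (h : StableTendsto 𝒢 P P' π V l V')
    (h𝒢 : 𝒢 ≤ mΩ) (hπ : Measurable π) (hV' : AEMeasurable V' P')
    (htight : ∀ ε : ℝ, 0 < ε → ∃ R : ℝ, 0 < R ∧ ∀ T, P.real {ω | R ≤ ‖V T ω‖} ≤ ε)
    (hB : ∀ i j, Measurable[𝒢] fun ω => B ω i j) (hU : ∀ T, AEMeasurable (U T) P)
    (hUV : TendstoInMeasure P (fun T ω => U T ω - act (B ω) (V T ω)) l fun _ => 0)
    {g : E d → ℝ} (hg : Continuous g) (hgc : HasCompactSupport g) {Φ : Ω → ℝ}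
    (hΦ : Measurable[𝒢] Φ) {K : ℝ} (hΦK : ∀ ω, |Φ ω| ≤ K) :
    Tendsto (fun T => ∫ ω, g (U T ω) * Φ ω ∂P) l
      (𝓝 (∫ ω', g (act (B (π ω')) (V' ω')) * Φ (π ω') ∂P')) := by
  obtain ⟨M, hgM⟩ := hgc.exists_bound_of_continuous hg
  have hgu : UniformContinuous g := hgc.uniformContinuous_of_continuous hg
  have h1 := h.tendsto_integral_act h𝒢 hπ hV' htight hB hgu hgM hΦ hΦK
  have h2 : Tendsto (fun T => ∫ ω, g (U T ω) * Φ ω ∂P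
      - ∫ ω, g (act (B ω) (V T ω)) * Φ ω ∂P) l (𝓝 0) := by
    rw [Metric.tendsto_nhds]
    intro ε hε
    have hK : 0 ≤ K := by
      obtain ⟨ω⟩ : Nonempty Ω := P.nonempty_of_neZero
      exact (abs_nonneg _).trans (hΦK ω)
    obtain ⟨δ, hδ, hgδ⟩ := Metric.uniformContinuous_iff.1 hgu (ε / (2 * (K + 1))) (by positivity)
    rw [tendstoInMeasure_iff_measureReal_norm] at hUV
    have h3 := ((hUV δ hδ).const_mul (2 * M)).const_add (ε / (2 * (K + 1))) |>.const_mul K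
    rw [mul_zero, add_zero] at h3
    have h4 : K * (ε / (2 * (K + 1))) < ε := by
      rw [mul_div_assoc', div_lt_iff₀ (by positivity)]
      nlinarith
    filter_upwards [h3.eventually (gt_mem_nhds h4)] with T hT
    rw [Real.dist_eq, sub_zero]
    refine lt_of_le_of_lt ?_ hT
    simpa using abs_integral_mul_sub_le (P := P) hg (ε := ε / (2 * (K + 1))) (δ := δ) hgM
      (by positivity) (fun x y hxy => (hgδ (by rwa [dist_eq_norm])).le) (hU T)
      (aemeasurable_act (fun i j => (hB i j).mono h𝒢 le_rfl) (h.aemeasurable T))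
      (hΦ.mono h𝒢 le_rfl).aestronglyMeasurable hΦK
  simpa using h2.add h1

/-- Convergence of weighted integrals of functions of polynomial growth, for random vectors
that are asymptotically a random linear image of a stably convergent family. -/
theorem StableTendsto.tendsto_integral_of_growth [l.NeBot] (h : StableTendsto 𝒢 P P' π V l V')
    (h𝒢 : 𝒢 ≤ mΩ) (hπ : Measurable π) (hV' : AEMeasurable V' P')
    (htight : ∀ ε : ℝ, 0 < ε → ∃ R : ℝ, 0 < R ∧ ∀ T, P.real {ω | R ≤ ‖V T ω‖} ≤ ε)
    (hB : ∀ i j, Measurable[𝒢] fun ω => B ω i j) (hU : ∀ T, AEMeasurable (U T) P)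
    (hUb : ∀ T, ∃ R : ℝ, ∀ ω, ‖U T ω‖ ≤ R)
    (hUV : TendstoInMeasure P (fun T ω => U T ω - act (B ω) (V T ω)) l fun _ => 0)
    {C L p : ℝ} (hp : 0 < p) (hpL : p < L)
    (htail : ∀ᶠ T in l, ∀ r : ℝ, 0 < r → P.real {ω | r ≤ ‖U T ω‖} ≤ C / r ^ L)
    {Φ : Ω → ℝ} (hΦ : Measurable[𝒢] Φ) {K : ℝ} (hΦK : ∀ ω, |Φ ω| ≤ K)
    {f : E d → ℝ} (hf : Continuous f)
    (hfp : f =O[Bornology.cobounded (E d)] fun u => ‖u‖ ^ p) :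
    (∀ T, Integrable (fun ω => f (U T ω) * Φ ω) P) ∧
      Integrable (fun ω' => f (act (B (π ω')) (V' ω')) * Φ (π ω')) P' ∧
      Tendsto (fun T => ∫ ω, f (U T ω) * Φ ω ∂P) l
        (𝓝 (∫ ω', f (act (B (π ω')) (V' ω')) * Φ (π ω') ∂P')) := by
  have hK : 0 ≤ K := by
    obtain ⟨ω⟩ : Nonempty Ω := P.nonempty_of_neZero
    exact (abs_nonneg _).trans (hΦK ω)
  obtain ⟨A, hA, hfA⟩ := exists_growth_bound hf hfp
  -- A moment of order s < L is bounded by the tail, and s > p gives uniform integrability of f.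
  obtain ⟨s, hps, hsL⟩ := exists_between hpL
  have hs : 0 < s := hp.trans hps
  obtain ⟨C', hC', hmom⟩ := exists_moment_bound (P := P) hs hsL C
  have hUint : ∀ (T) (k : E d → ℝ), Continuous k → ∀ Ψ : Ω → ℝ, AEStronglyMeasurable Ψ P →
      (∃ K', ∀ ω, |Ψ ω| ≤ K') → Integrable (fun ω => k (U T ω) * Ψ ω) P := by
    rintro T k hk Ψ hΨ ⟨K', hK'⟩
    obtain ⟨R, hR⟩ := hUb T
    obtain ⟨M, hM⟩ := (isCompact_closedBall (0 : E d) R).exists_bound_of_continuousOn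
      hk.continuousOn
    exact integrable_mul_of_bounded (hk.comp_aestronglyMeasurable (hU T).aestronglyMeasurable) hΨ
      (fun ω => hM _ (by simpa using hR ω)) hK'
  have hΦm : AEStronglyMeasurable Φ P := (hΦ.mono h𝒢 le_rfl).aestronglyMeasurable
  have hpow : Continuous fun u : E d => ‖u‖ ^ s := continuous_norm.rpow_const fun _ => Or.inr hs.le
  have hpowint : ∀ T, Integrable (fun ω => ‖U T ω‖ ^ s) P := fun T => by
    simpa using hUint T _ hpow (fun _ => 1) aestronglyMeasurable_const ⟨1, fun _ => by simp⟩
  have hmomU : ∀ᶠ T in l, ∫ ω, ‖U T ω‖ ^ s ∂P ≤ C' := by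
    filter_upwards [htail] with T hT
    rw [integral_eq_lintegral_of_nonneg_ae (Eventually.of_forall fun ω => by positivity)
      (hpowint T).aestronglyMeasurable]
    exact ENNReal.toReal_le_of_le_ofReal hC'
      (hmom _ (fun ω => norm_nonneg _) (hU T).norm hT)
  set W : Ω' → E d := fun ω' => act (B (π ω')) (V' ω') with hW
  have hWm : AEMeasurable W P' :=
    aemeasurable_act (A := fun ω' => B (π ω')) (fun i j => ((hB i j).mono h𝒢 le_rfl).comp hπ) hV'
  have hΦπ : AEStronglyMeasurable (fun ω' => Φ (π ω')) P' :=
    ((hΦ.mono h𝒢 le_rfl).comp hπ).aestronglyMeasurable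
  have hcut : ∀ k : E d → ℝ, Continuous k → ∀ n, ∀ Ψ : Ω → ℝ, Measurable[𝒢] Ψ → ∀ K',
      (∀ ω, |Ψ ω| ≤ K') → Tendsto (fun T => ∫ ω, (k (U T ω) * cutoff n (U T ω)) * Ψ ω ∂P) l
        (𝓝 (∫ ω', (k (W ω') * cutoff n (W ω')) * Ψ (π ω') ∂P')) :=
    fun k hk n Ψ hΨ K' hK' => h.tendsto_integral_of_tendstoInMeasure h𝒢 hπ hV' htight hB hU hUV
      (hk.mul (continuous_cutoff n)) (hasCompactSupport_mul_cutoff k n) hΨ hK'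
  have hWcut : ∀ n, Integrable (fun ω' => ‖W ω'‖ ^ s * cutoff n (W ω')) P' := fun n => by
    have hc := hpow.mul (continuous_cutoff (d := d) n)
    obtain ⟨M, hM⟩ := (hasCompactSupport_mul_cutoff (fun u : E d => ‖u‖ ^ s)
      n).exists_bound_of_continuous hc
    exact Integrable.of_bound (hc.comp_aestronglyMeasurable hWm.aestronglyMeasurable) M
      (Eventually.of_forall fun ω' => hM _)
  -- The limit inherits the moment bound: truncated moments converge along T, and Fatou's lemma
  -- below removes the truncation.
  have hWmom : ∀ n, ∫⁻ ω', ENNReal.ofReal (‖W ω'‖ ^ s * cutoff n (W ω')) ∂P'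
      ≤ ENNReal.ofReal C' := fun n => by
    rw [← ofReal_integral_eq_lintegral_ofReal (hWcut n) (Eventually.of_forall fun ω' =>
      mul_nonneg (by positivity) (cutoff_nonneg _ _))]
    refine ENNReal.ofReal_le_ofReal ?_
    have h1 := hcut _ hpow n (fun _ => 1) measurable_const 1 (fun _ => by simp)
    simp only [mul_one] at h1
    refine le_of_tendsto h1 ?_
    filter_upwards [hmomU] with T hT
    refine le_trans (integral_mono_of_nonneg (Eventually.of_forall fun ω =>
      mul_nonneg (by positivity) (cutoff_nonneg _ _)) (hpowint T)
      (Eventually.of_forall fun ω => ?_)) hT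
    exact mul_le_of_le_one_right (by positivity) (cutoff_le_one _ _)
  have hWint : Integrable (fun ω' => ‖W ω'‖ ^ s) P' := by
    refine ⟨hpow.comp_aestronglyMeasurable hWm.aestronglyMeasurable, ?_⟩
    rw [hasFiniteIntegral_iff_ofReal (Eventually.of_forall fun ω' => by positivity)]
    have h1 : ∀ ω', liminf (fun n => ENNReal.ofReal (‖W ω'‖ ^ s * cutoff n (W ω'))) atTop
        = ENNReal.ofReal (‖W ω'‖ ^ s) := fun ω' =>
      ((ENNReal.continuous_ofReal.tendsto _).comp
        (tendsto_mul_cutoff (fun u => ‖u‖ ^ s) (W ω'))).liminf_eq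
    calc ∫⁻ ω', ENNReal.ofReal (‖W ω'‖ ^ s) ∂P'
        = ∫⁻ ω', liminf (fun n => ENNReal.ofReal (‖W ω'‖ ^ s * cutoff n (W ω'))) atTop ∂P' := by
          simp only [h1]
      _ ≤ liminf (fun n => ∫⁻ ω', ENNReal.ofReal (‖W ω'‖ ^ s * cutoff n (W ω')) ∂P') atTop :=
          lintegral_liminf_le' fun n => (hWcut n).aestronglyMeasurable.aemeasurable.ennreal_ofReal
      _ ≤ ENNReal.ofReal C' := liminf_le_of_frequently_le' (Frequently.of_forall hWmom)
      _ < ∞ := ENNReal.ofReal_lt_top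
  have hdom : ∀ u : E d, |f u| ≤ A * (2 + ‖u‖ ^ s) := fun u => by
    refine (hfA u).trans (mul_le_mul_of_nonneg_left ?_ hA)
    rcases le_total ‖u‖ 1 with hu | hu
    · have h1 : ‖u‖ ^ p ≤ 1 := Real.rpow_le_one (norm_nonneg _) hu hp.le
      have h2 : 0 ≤ ‖u‖ ^ s := by positivity
      linarith
    · have h1 : ‖u‖ ^ p ≤ ‖u‖ ^ s := Real.rpow_le_rpow_of_exponent_le hu hps.le
      linarith
  have hdomint : Integrable (fun ω' => A * (2 + ‖W ω'‖ ^ s) * K) P' :=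
    (((integrable_const (2 : ℝ)).add hWint).const_mul A).mul_const K
  have hfW : Integrable (fun ω' => f (W ω') * Φ (π ω')) P' := by
    refine hdomint.mono' ((hf.comp_aestronglyMeasurable hWm.aestronglyMeasurable).mul hΦπ)
      (Eventually.of_forall fun ω' => ?_)
    rw [norm_mul]
    exact mul_le_mul (hdom _) (hΦK _) (norm_nonneg _) ((abs_nonneg _).trans (hdom _))
  have hfU : ∀ T, Integrable (fun ω => f (U T ω) * Φ ω) P := fun T =>
    hUint T f hf Φ hΦm ⟨K, hΦK⟩
  refine ⟨hfU, hfW, ?_⟩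
  -- Second interchange of limits. Uniformity is only along the filter, since the moment bound holds
  -- only eventually in T.
  refine TendstoUniformlyOnFilter.tendsto_of_eventually_tendsto
    (F := fun n T => ∫ ω, (f (U T ω) * cutoff n (U T ω)) * Φ ω ∂P) (p := atTop)
    (L := fun n => ∫ ω', (f (W ω') * cutoff n (W ω')) * Φ (π ω') ∂P') ?_
    (Eventually.of_forall fun n => hcut f hf n Φ hΦ K hΦK) ?_
  · rw [Metric.tendstoUniformlyOnFilter_iff]
    intro ε hε
    have h1 : Tendsto (fun n : ℕ => 2 * A * (n : ℝ) ^ (p - s) * C' * K) atTop (𝓝 0) := by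
      have h2 := (tendsto_rpow_neg_atTop (sub_pos.2 hps)).comp
        (tendsto_natCast_atTop_atTop (R := ℝ))
      simpa [Function.comp_def] using ((h2.const_mul (2 * A)).mul_const C').mul_const K
    have h3 := ((h1.eventually (gt_mem_nhds hε)).and (eventually_ge_atTop 1)).prod_mk hmomU
    filter_upwards [h3] with z hz
    obtain ⟨⟨hz1, hz2⟩, hz3⟩ := hz
    rw [Real.dist_eq]
    refine lt_of_le_of_lt ?_ hz1
    have hcutint := hUint z.2 (fun u => f u * cutoff z.1 u) (hf.mul (continuous_cutoff z.1)) Φ hΦm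
      ⟨K, hΦK⟩
    rw [← integral_sub (hfU z.2) hcutint]
    have h4 : ∀ ω, ‖f (U z.2 ω) * Φ ω - f (U z.2 ω) * cutoff z.1 (U z.2 ω) * Φ ω‖
        ≤ 2 * A * (z.1 : ℝ) ^ (p - s) * ‖U z.2 ω‖ ^ s * K := fun ω => by
      rw [← sub_mul, norm_mul]
      exact mul_le_mul (abs_sub_mul_cutoff_le hA hp hps hfA hz2 _) (hΦK ω) (norm_nonneg _)
        (by positivity)
    refine (norm_integral_le_of_norm_le
      (((hpowint z.2).const_mul (2 * A * (z.1 : ℝ) ^ (p - s))).mul_const K)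
      (Eventually.of_forall h4)).trans ?_
    rw [integral_mul_const, integral_const_mul]
    gcongr
  · refine tendsto_integral_of_dominated_convergence (fun ω' => A * (2 + ‖W ω'‖ ^ s) * K)
      (fun n => ?_) hdomint (fun n => Eventually.of_forall fun ω' => ?_)
      (Eventually.of_forall fun ω' => (tendsto_mul_cutoff f (W ω')).mul_const _)
    · exact ((hf.mul (continuous_cutoff n)).comp_aestronglyMeasurable
        hWm.aestronglyMeasurable).mul hΦπ
    · rw [norm_mul, norm_mul, Real.norm_of_nonneg (cutoff_nonneg n _)]
      have h1 := mul_le_of_le_one_right (norm_nonneg (f (W ω'))) (cutoff_le_one n (W ω'))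
      exact mul_le_mul (h1.trans (hdom _)) (hΦK _) (norm_nonneg _)
        ((abs_nonneg _).trans (hdom _))

end Convergence

end QLA

end

/-! ### Assembly of the theorem. -/

theorem theorem201911221015
    {Ω : Type*} (𝒢 : MeasurableSpace Ω) [mΩ : MeasurableSpace Ω] (P : Measure Ω) [IsProbabilityMeasure P]
    {d : ℕ} (hd : 0 < d)
    -- the index set of `T`
    (𝕋 : Set ℝ) (h𝕋_nonneg : ∀ t ∈ 𝕋, 0 ≤ t) (h𝕋_unbdd : ¬ BddAbove 𝕋)
    -- the parameter set
    (Θ : Set (QLA.E d)) (hΘ_open : IsOpen Θ) (hΘ_bdd : Bornology.IsBounded Θ)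
    (θstar : QLA.E d) (hθstar : θstar ∈ Θ)
    -- the random fields
    (H : 𝕋 → Ω → QLA.E d → ℝ)
    (hH_meas : ∀ T, ∀ θ ∈ Θ, Measurable fun ω => H T ω θ)
    (hH_C2 : ∀ T ω, ContDiffOn ℝ 2 (H T ω) Θ)
    (hH_cont : ∀ T ω, ContinuousOn (H T ω) (closure Θ))
    -- the scaling matrices
    (a : 𝕋 → GL (Fin d) ℝ)
    (ha_zero : Tendsto (fun T => ‖(a T : QLA.Mat d)‖) atTop (𝓝 0))
    (C₀ : ℝ) (hC₀ : 1 ≤ C₀)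
    (ha_bal : ∀ T,
      (QLA.rate (a T : QLA.Mat d))⁻¹
          ≤ QLA.lambdaMax ((a T : QLA.Mat d).transpose * (a T : QLA.Mat d)) ∧
      QLA.lambdaMax ((a T : QLA.Mat d).transpose * (a T : QLA.Mat d))
          ≤ C₀ * (QLA.rate (a T : QLA.Mat d))⁻¹)
    -- the limit field and the limit information
    (Y : Ω → QLA.E d → ℝ)
    (hY_meas : ∀ θ ∈ Θ, Measurable fun ω => Y ω θ)
    (hY_cont : ∀ ω, ContinuousOn (Y ω) Θ)
    (Γ : Ω → QLA.Mat d) (hΓ_symm : ∀ ω, (Γ ω).IsSymm)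
    -- the sub-σ-field `𝒢` with `σ[Γ] ⊆ 𝒢 ⊆ ℱ`
    (h𝒢 : 𝒢 ≤ mΩ) (hΓ_meas : ∀ i j, Measurable[𝒢] fun ω => Γ ω i j)
    -- the conditions [S1], [S2], [S3]
    (L p : ℝ) (hp : 0 < p) (hpL : p < L)
    (q : QLA.Params) (hS1 : QLA.CondS1 q)
    (hS2 : QLA.CondS2 P q L Θ θstar Y Γ)
    (hS3 : QLA.CondS3 P q L Θ θstar (fun T => (a T : QLA.Mat d)) H Y Γ)
    -- an extension of the probability space, and the limit of the scores on it
    {Ω' : Type*} [MeasurableSpace Ω'] (P' : Measure Ω') [IsProbabilityMeasure P']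
    (π : Ω' → Ω) (hπ : MeasurePreserving π P' P)
    (Δ : Ω' → QLA.E d) (hΔ_meas : Measurable Δ)
    (hstable : QLA.StableTendsto 𝒢 P P' π
      (fun T ω => QLA.score (a T : QLA.Mat d) (H T ω) θstar) atTop Δ)
    -- the estimators
    (θhat : 𝕋 → Ω → QLA.E d) (hθhat : ∀ T, QLA.IsQMLE Θ (H T) (θhat T)) :
    TendstoInMeasure P
      (fun T ω => QLA.act (a T : QLA.Mat d)⁻¹ (θhat T ω - θstar)
        - QLA.act (Γ ω)⁻¹ (QLA.score (a T : QLA.Mat d) (H T ω) θstar))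
      atTop (fun _ => 0) ∧
    ∀ (Φ : Ω → ℝ), Measurable[𝒢] Φ → (∃ K : ℝ, ∀ ω, |Φ ω| ≤ K) →
    ∀ (f : QLA.E d → ℝ), Continuous f →
      f =O[Bornology.cobounded (QLA.E d)] (fun u => ‖u‖ ^ p) →
      (∀ T, Integrable
        (fun ω => f (QLA.act (a T : QLA.Mat d)⁻¹ (θhat T ω - θstar)) * Φ ω) P) ∧
      Integrable (fun ω' => f (QLA.act (Γ (π ω'))⁻¹ (Δ ω')) * Φ (π ω')) P' ∧
      Tendsto
        (fun T => ∫ ω, f (QLA.act (a T : QLA.Mat d)⁻¹ (θhat T ω - θstar)) * Φ ω ∂P)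
        atTop
        (𝓝 (∫ ω', f (QLA.act (Γ (π ω'))⁻¹ (Δ ω')) * Φ (π ω') ∂P')) := by
  -- Needed for `atTop` on 𝕋 to be a nontrivial filter.
  have hne : Nonempty 𝕋 := by
    by_contra hcon
    exact h𝕋_unbdd (by simp [Set.not_nonempty_iff_eq_empty.1 (mt Set.Nonempty.to_subtype hcon)])
  have S : QLA.Setting P atTop q L C₀ Θ θstar a H Y Γ θhat :=
    { dim_pos := hd
      isOpen := hΘ_open
      isBounded := hΘ_bdd
      mem := hθstar
      field_meas := hH_meas
      field_C2 := hH_C2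
      field_cont := hH_cont
      tendsto_zero := ha_zero
      one_le := hC₀
      balanced := fun T => (ha_bal T).2
      limit_meas := hY_meas
      limit_cont := hY_cont
      info_symm := hΓ_symm
      info_meas := fun i j => (hΓ_meas i j).mono h𝒢 le_rfl
      L_pos := hp.trans hpL
      condS1 := hS1
      condS2 := hS2
      condS3 := hS3
      score_meas := hstable.aemeasurable
      est := hθhat }
  refine ⟨S.tendstoInMeasure, fun Φ hΦ ⟨K, hK⟩ f hf hfp => ?_⟩
  obtain ⟨C, hC⟩ := S.exists_error_tail
  exact hstable.tendsto_integral_of_growth h𝒢 hπ.measurable hΔ_meas.aemeasurable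
    S.tight_score (QLA.measurable_inv_of_entries hΓ_meas)
    (fun T => ((QLA.continuous_act _).measurable.comp
      ((hθhat T).measurable.sub measurable_const)).aemeasurable)
    S.exists_error_bound S.tendstoInMeasure hp hpL hC hΦ hK hf hfp
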